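/- Let $d\ge 1$ be an integer, $s\in(0,1)$ and $\lambda,\Lambda>0$. Write $B_R(x)$ for the open ball in $\mathbb R^d$, $B_R=B_R(0)$, $I_R=(-R^{2s},0]$, $Q_R=B_R\times I_R$ and $d((x,t),(y,\tau))=\max\{|x-y|,|t-\tau|^{1/(2s)}\}$. For $\rho\ge 0$ let $\mathcal K_\rho$ be the set of measurable $K\colon\mathbb R^d\to[0,\infty)$ such that $K(y)\ge\lambda\min\{|y|^{-d-2s},\rho^{-d-2s}\}$ for all $y\ne0$ (the minimum being $|y|^{-d-2s}$ if $\rho=0$), $\int_{B_{2r}\setminus B_r}K(y)\,dy\le\Lambda r^{-2s}$ for all $r>0$, and, if $s=1/2$, $\int_{B_{2r}\setminus B_r}yK(y)\,dy=0$ for all $r>0$. Put $\mathcal M_\rho^+w(x)=\sup_{K\in\mathcal K_\rho}L_Kw(x)$ and $\mathcal M_\rho^-w(x)=\inf_{K\in\mathcal K_\rho}L_Kw(x)$, where $L_Kw(x)=\int_{\mathbb R^d}\delta_yw(x)K(y)\,dy$ and $\delta_yw(x)$ equals $w(x+y)-w(x)$ if $s<1/2$, $w(x+y)-w(x)-y\cdot\nabla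 w(x)\mathbf 1_{B_1}(y)$ if $s=1/2$, and $w(x+y)-w(x)-y\cdot\nabla w(x)$ if $s>1/2$. Here $u\in L^\infty(\mathbb R^d\times I)$ means that $u$ is defined at every point, is measurable and essentially bounded on $\mathbb R^d\times I$, and that each slice $u(\cdot,t)$, $t\in I$, is measurable and essentially bounded on $\mathbb R^d$; $\|u\|_{L^\infty(\mathbb R^d\times I)}$ is the essential supremum of $|u|$. Such a function $u$ satisfies $\partial_tu-F(u)\le f$ in $\Omega\times I$ in the viscosity sense if it is upper semicontinuous in $\Omega\times I$ and, whenever $(x_0,t_0)\in\Omega\times I$, $\varepsilon>0$, $Z:=B_\varepsilon(x_0)\times(t_0-\varepsilon,t_0]\subseteq\Omega\times I$, and $\varphi$ is left-differentiable in time and $C^{1,1}$ in space on $Z$ with $\varphi(x_0,t_0)=u(x_0,t_0)$ and $u\le\varphi$ on $Z$, the function $v$ equal to $\varphi$ on $Z$ and to $u$ elsewhere satisfies $\partial_tv(x_0,t_0)-F(v)(x_0,t_0)\le f(x_0,t_0)$, where $\partial_t$ is the left derivative. The inequality $\ge$ is defined in the same way with lower semicontinuity and $u\ge\varphi$ on $Z$.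 **Statement.** Consider $\rho\ge0$ with $\mathcal K_\rho\ne\emptyset$, $R>2\rho$, $A\ge0$ and $u\in L^\infty(\mathbb R^d\times I_R)$, and the estimate $$\sup_{\substack{(x,t),(y,\tau)\in Q_{R/4}\\ d((x,t),(y,\tau))>\rho}}\frac{|u(x,t)-u(y,\tau)|}{d((x,t),(y,\tau))^\alpha}\le\frac{C}{R^\alpha}\left(\|u\|_{L^\infty(\mathbb R^d\times I_R)}+R^{2s}A\right).\qquad(*)$$ (a) If $s\ge1/2$, then for every $R_0>0$ there are $\alpha\in(0,2s)$ and $C>0$, depending only on $d,s,\lambda,\Lambda$ and $R_0$, such that $(*)$ holds for all such $\rho,R,A,u$ with $R\le R_0$ for which, in the viscosity sense, $$\partial_tu-\Lambda|\nabla u|-\mathcal M_\rho^+u\le A\quad\text{and}\quad\partial_tu+\Lambda|\nabla u|-\mathcal M_\rho^-u\ge-A\quad\text{in }Q_R.$$ (b) For every $s\in(0,1)$ there are $\alpha\in(0,2s)$ and $C>0$, depending only on $d,s,\lambda$ and $\Lambda$, such that $(*)$ holds for all such $\rho,R,A,u$ for which, in the viscosity sense, $$\partial_tu-\mathcal M_\rho^+u\le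 A\quad\text{and}\quad\partial_tu-\mathcal M_\rho^-u\ge-A\quad\text{in }Q_R.$$ -/

import Mathlib

open MeasureTheory Set

/-- Euclidean space `ℝᵈ`. -/
abbrev Space (d : ℕ) : Type := EuclideanSpace ℝ (Fin d)

/-- `min {|y|^(-d-2s), ρ^(-d-2s)}`, with the convention `0^(-d-2s) = ∞`, so that the minimum
is `|y|^(-d-2s)` when `ρ = 0`. -/
noncomputable def lowerKernel (d : ℕ) (s ρ : ℝ) (y : Space d) : ℝ :=
  if ρ = 0 then ‖y‖ ^ (-(d : ℝ) - 2 * s)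
  else min (‖y‖ ^ (-(d : ℝ) - 2 * s)) (ρ ^ (-(d : ℝ) - 2 * s))

/-- The class `𝒦_ρ` of admissible kernels `K : ℝᵈ → [0, ∞)`. -/
structure IsAdmissibleKernel (d : ℕ) (s lam Lam ρ : ℝ) (K : Space d → ℝ) : Prop where
  measurable : Measurable K
  nonneg : ∀ y, 0 ≤ K y
  /-- `K(y) ≥ λ min {|y|^(-d-2s), ρ^(-d-2s)}` for `y ≠ 0`. -/
  lower : ∀ y, y ≠ 0 → lam * lowerKernel d s ρ y ≤ K y
  /-- `∫_{B_{2r} \ B_r} K ≤ Λ r^(-2s)`; the integral is finite. -/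
  integrableOn : ∀ r : ℝ, 0 < r →
    IntegrableOn K (Metric.ball 0 (2 * r) \ Metric.ball 0 r)
  upper : ∀ r : ℝ, 0 < r →
    ∫ y in Metric.ball (0 : Space d) (2 * r) \ Metric.ball 0 r, K y ≤ Lam * r ^ (-(2 * s))
  /-- If `s = 1/2`, then `∫_{B_{2r} \ B_r} y K(y) dy = 0`. -/
  symm : s = 1 / 2 → ∀ r : ℝ, 0 < r →
    ∫ y in Metric.ball (0 : Space d) (2 * r) \ Metric.ball 0 r, K y • y = 0

/-- The class `𝒦_ρ` as a set of functions. -/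
def kernelClass (d : ℕ) (s lam Lam ρ : ℝ) : Set (Space d → ℝ) :=
  {K | IsAdmissibleKernel d s lam Lam ρ K}

open Classical in
/-- The difference operator `δ_y w(x)`. -/
noncomputable def diffOp {d : ℕ} (s : ℝ) (w : Space d → ℝ) (x y : Space d) : ℝ :=
  if s < 1 / 2 then w (x + y) - w x
  else if s = 1 / 2 then
    w (x + y) - w x - (if y ∈ Metric.ball 0 1 then inner ℝ y (gradient w x) else 0)
  else w (x + y) - w x - inner ℝ y (gradient w x)

/-- `L_K w(x) = ∫ δ_y w(x) K(y) dy`. -/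
noncomputable def nonlocalOp {d : ℕ} (s : ℝ) (K : Space d → ℝ) (w : Space d → ℝ)
    (x : Space d) : ℝ :=
  ∫ y, diffOp s w x y * K y

/-- The extremal operator `ℳ_ρ⁺ w(x) = sup_{K ∈ 𝒦_ρ} L_K w(x)`. -/
noncomputable def pucciSup {d : ℕ} (s lam Lam ρ : ℝ) (w : Space d → ℝ) (x : Space d) : ℝ :=
  sSup ((fun K => nonlocalOp s K w x) '' kernelClass d s lam Lam ρ)

/-- The extremal operator `ℳ_ρ⁻ w(x) = inf_{K ∈ 𝒦_ρ} L_K w(x)`. -/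
noncomputable def pucciInf {d : ℕ} (s lam Lam ρ : ℝ) (w : Space d → ℝ) (x : Space d) : ℝ :=
  sInf ((fun K => nonlocalOp s K w x) '' kernelClass d s lam Lam ρ)

/-- `u ∈ L^∞(ℝᵈ × I)` for a function `u` defined at every point. Every time slice is also in
`L^∞(ℝᵈ)`, so that the nonlocal operators can be evaluated at every time `t ∈ I`. -/
def IsLInfty {d : ℕ} (I : Set ℝ) (u : Space d → ℝ → ℝ) : Prop :=
  MemLp (Function.uncurry u) ⊤ (volume.restrict (univ ×ˢ I)) ∧
    ∀ t ∈ I, MemLp (fun x => u x t) ⊤ volume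

/-- `‖u‖_{L^∞(ℝᵈ × I)}`, the essential supremum norm. -/
noncomputable def normLInfty {d : ℕ} (I : Set ℝ) (u : Space d → ℝ → ℝ) : ℝ :=
  (eLpNorm (Function.uncurry u) ⊤ (volume.restrict (univ ×ˢ I))).toReal

/-- The left-sided cylinder `B_ε(x₀) × (t₀ - ε, t₀]`. -/
def leftCyl {d : ℕ} (x₀ : Space d) (t₀ ε : ℝ) : Set (Space d × ℝ) :=
  Metric.ball x₀ ε ×ˢ Ioc (t₀ - ε) t₀

/-- `φ` is left-differentiable in time and `C^{1,1}` in space on `B_ε(x₀) × (t₀ - ε, t₀]`. -/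
structure IsTestFunction {d : ℕ} (x₀ : Space d) (t₀ ε : ℝ) (φ : Space d → ℝ → ℝ) : Prop where
  time : ∀ x ∈ Metric.ball x₀ ε, ∀ t ∈ Ioc (t₀ - ε) t₀,
    DifferentiableWithinAt ℝ (φ x) (Iic t) t
  space : ∀ t ∈ Ioc (t₀ - ε) t₀, DifferentiableOn ℝ (fun x => φ x t) (Metric.ball x₀ ε)
  spaceLip : ∀ t ∈ Ioc (t₀ - ε) t₀, ∃ L : NNReal,
    LipschitzOnWith L (gradient fun x => φ x t) (Metric.ball x₀ ε)

open Classical in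
/-- The function equal to `φ` on `B_ε(x₀) × (t₀ - ε, t₀]` and to `u` elsewhere. -/
noncomputable def glue {d : ℕ} (x₀ : Space d) (t₀ ε : ℝ) (φ u : Space d → ℝ → ℝ) :
    Space d → ℝ → ℝ :=
  fun x t => if (x, t) ∈ leftCyl x₀ t₀ ε then φ x t else u x t

/-- The left derivative in time `∂_t v(x, t)`. -/
noncomputable def leftTimeDeriv {d : ℕ} (v : Space d → ℝ → ℝ) (x : Space d) (t : ℝ) : ℝ :=
  derivWithin (v x) (Iic t) t

/-- `u` solves `∂_t u - F(u) ≤ f` in `Ω × I` in the viscosity sense, where `F` acts on functions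
of the space variable. -/
def IsViscositySubsolution {d : ℕ} (F : (Space d → ℝ) → Space d → ℝ) (f : Space d → ℝ → ℝ)
    (Ω : Set (Space d)) (I : Set ℝ) (u : Space d → ℝ → ℝ) : Prop :=
  IsLInfty I u ∧ UpperSemicontinuousOn (Function.uncurry u) (Ω ×ˢ I) ∧
  ∀ x₀ ∈ Ω, ∀ t₀ ∈ I, ∀ ε : ℝ, 0 < ε → leftCyl x₀ t₀ ε ⊆ Ω ×ˢ I →
    ∀ φ : Space d → ℝ → ℝ, IsTestFunction x₀ t₀ ε φ → u x₀ t₀ = φ x₀ t₀ →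
      (∀ p ∈ leftCyl x₀ t₀ ε, u p.1 p.2 ≤ φ p.1 p.2) →
      leftTimeDeriv (glue x₀ t₀ ε φ u) x₀ t₀ - F (fun x => glue x₀ t₀ ε φ u x t₀) x₀ ≤ f x₀ t₀

/-- `u` solves `∂_t u - F(u) ≥ f` in `Ω × I` in the viscosity sense. -/
def IsViscositySupersolution {d : ℕ} (F : (Space d → ℝ) → Space d → ℝ) (f : Space d → ℝ → ℝ)
    (Ω : Set (Space d)) (I : Set ℝ) (u : Space d → ℝ → ℝ) : Prop :=
  IsLInfty I u ∧ LowerSemicontinuousOn (Function.uncurry u) (Ω ×ˢ I) ∧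
  ∀ x₀ ∈ Ω, ∀ t₀ ∈ I, ∀ ε : ℝ, 0 < ε → leftCyl x₀ t₀ ε ⊆ Ω ×ˢ I →
    ∀ φ : Space d → ℝ → ℝ, IsTestFunction x₀ t₀ ε φ → u x₀ t₀ = φ x₀ t₀ →
      (∀ p ∈ leftCyl x₀ t₀ ε, φ p.1 p.2 ≤ u p.1 p.2) →
      f x₀ t₀ ≤ leftTimeDeriv (glue x₀ t₀ ε φ u) x₀ t₀ - F (fun x => glue x₀ t₀ ε φ u x t₀) x₀

/-- `I_R = (-R^{2s}, 0]`. -/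
noncomputable def timeInterval (s R : ℝ) : Set ℝ := Ioc (-R ^ (2 * s)) 0

/-- `Q_R = B_R × I_R`. -/
noncomputable def parCyl (d : ℕ) (s R : ℝ) : Set (Space d × ℝ) :=
  Metric.ball 0 R ×ˢ timeInterval s R

/-- The parabolic distance `max {|x - y|, |t - τ|^{1/(2s)}}`. -/
noncomputable def parDist {d : ℕ} (s : ℝ) (p q : Space d × ℝ) : ℝ :=
  max ‖p.1 - q.1‖ (|p.2 - q.2| ^ (1 / (2 * s)))

/-- `∂_t u - Λ|∇u| - ℳ_ρ⁺ u ≤ A` and `∂_t u + Λ|∇u| - ℳ_ρ⁻ u ≥ -A` in `Q_R`, in the viscosity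
sense, for `u ∈ L^∞(ℝᵈ × I_R)`. -/
def SolvesWithDrift {d : ℕ} (s lam Lam ρ R A : ℝ) (u : Space d → ℝ → ℝ) : Prop :=
  IsViscositySubsolution (fun w x => pucciSup s lam Lam ρ w x + Lam * ‖gradient w x‖)
    (fun _ _ => A) (Metric.ball 0 R) (timeInterval s R) u ∧
  IsViscositySupersolution (fun w x => pucciInf s lam Lam ρ w x - Lam * ‖gradient w x‖)
    (fun _ _ => -A) (Metric.ball 0 R) (timeInterval s R) u

/-- `∂_t u - ℳ_ρ⁺ u ≤ A` and `∂_t u - ℳ_ρ⁻ u ≥ -A` in `Q_R`, in the viscosity sense, for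
`u ∈ L^∞(ℝᵈ × I_R)`. -/
def SolvesWithoutDrift {d : ℕ} (s lam Lam ρ R A : ℝ) (u : Space d → ℝ → ℝ) : Prop :=
  IsViscositySubsolution (pucciSup s lam Lam ρ) (fun _ _ => A)
    (Metric.ball 0 R) (timeInterval s R) u ∧
  IsViscositySupersolution (pucciInf s lam Lam ρ) (fun _ _ => -A)
    (Metric.ball 0 R) (timeInterval s R) u

/-- The partial Hölder estimate
`sup |u(x,t) - u(y,τ)| / d((x,t),(y,τ))^α ≤ C R^(-α) (‖u‖_{L^∞(ℝᵈ × I_R)} + R^{2s} A)`,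
the supremum being over pairs in `Q_{R/4}` at parabolic distance greater than `ρ`. -/
def PartialHolderEstimate {d : ℕ} (s ρ R A α C : ℝ) (u : Space d → ℝ → ℝ) : Prop :=
  ∀ p ∈ parCyl d s (R / 4), ∀ q ∈ parCyl d s (R / 4), ρ < parDist s p q →
    |u p.1 p.2 - u q.1 q.2| / parDist s p q ^ α
      ≤ C / R ^ α * (normLInfty (timeInterval s R) u + R ^ (2 * s) * A)

/-! Hölder regularity comes from decay of oscillation over shrinking cylinders, and the decay from a
growth lemma proved with an explicit barrier. Suppose `u` oscillates by at most `2h` below the level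
`S` at scale `r ≥ ρ`. The functions `S - u` and `u - (S - 2h)` add up to `2h`, so one of them
averages at least `h` over the first half of the cylinder; after replacing `u` by `-u` it is `S -
u`. The claim is then `u ≤ S - θh` in the second half.

The barrier is `S - m(t) b(x)` plus small increasing functions of time, with `b` a `C^{1,1}` bump
supported in the ball of radius `2r` and `m' = κ g - β m`, where `g(t)` is the integral of `S - u(·,
t)` over the ball of radius `r`. At a first contact the lower bound on the kernels makes the
extremal operator at most `-κ g` plus errors, which pays for the source in `m'`. The errors caused
by the bump and the drift are of size `m √b`, and that caused by the jump of height `m` is of size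
`m`. The damping `β m b` absorbs both where `b` is bounded below. Near the edge of the support `b`
is small, but there the jump from `b ≈ 0` to the centre of the bump gives a gain of size `m`
(`compDiff_bump_ge`, `damping_absorbs`). Hence no contact takes place, and `m` has grown by a fixed
multiple of `h` (`exists_growthProperty`).

Tails are carried through the iteration as integrals of `(u - S)⁺` against all admissible kernels.
They are controlled only outside a null set of times, since the norm is an essential supremum in
space-time; at the exceptional times a small monotone function of infinite slope
(`exists_monotone_steep_on_null`) outweighs the tail. The kernels look nondegenerate only at scales
at least `ρ`, so the iteration stops there and the estimate is restricted to pairs at distance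
greater than `ρ`. -/

/-! ### Weighted integrals and lower bounds of admissible kernels -/

theorem IsAdmissibleKernel.lintegral_annulus_le {d : ℕ} {s lam Lam ρ : ℝ} {K : Space d → ℝ}
    (hK : IsAdmissibleKernel d s lam Lam ρ K) {r : ℝ} (hr : 0 < r) :
    ∫⁻ y in Metric.ball (0 : Space d) (2 * r) \ Metric.ball 0 r, ENNReal.ofReal (K y)
      ≤ ENNReal.ofReal (Lam * r ^ (-(2 * s))) := by
  rw [← ofReal_integral_eq_lintegral_ofReal (hK.integrableOn r hr) (ae_of_all _ hK.nonneg)]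
  exact ENNReal.ofReal_le_ofReal (hK.upper r hr)

/-- Summation over annuli covering the part of `E` where the weight `f` is positive. -/
theorem IsAdmissibleKernel.lintegral_weight_le_tsum {d : ℕ} {s lam Lam ρ : ℝ} {K : Space d → ℝ}
    (hK : IsAdmissibleKernel d s lam Lam ρ K) {f : Space d → ℝ} (hf : Measurable f)
    {E : Set (Space d)} (hE : MeasurableSet E) {a c : ℕ → ℝ} (ha : ∀ n, 0 < a n)
    (hc : ∀ n, 0 ≤ c n)
    (hcover : ∀ y ∈ E, f y ≤ 0 ∨ ∃ n, a n ≤ ‖y‖ ∧ ‖y‖ < 2 * a n)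
    (hbound : ∀ n y, a n ≤ ‖y‖ → ‖y‖ < 2 * a n → f y ≤ c n) :
    ∫⁻ y in E, ENNReal.ofReal (f y * K y)
      ≤ ∑' n, ENNReal.ofReal (c n * (Lam * a n ^ (-(2 * s)))) := by
  have hm : Measurable fun y => ENNReal.ofReal (f y * K y) :=
    (hf.mul hK.measurable).ennreal_ofReal
  have hA : ∀ n, MeasurableSet (Metric.ball (0 : Space d) (2 * a n) \ Metric.ball 0 (a n)) :=
    fun n => measurableSet_ball.diff measurableSet_ball
  calc ∫⁻ y in E, ENNReal.ofReal (f y * K y)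
      = ∫⁻ y, E.indicator (fun y => ENNReal.ofReal (f y * K y)) y := (lintegral_indicator hE _).symm
    _ ≤ ∫⁻ y, ∑' n, (Metric.ball (0 : Space d) (2 * a n) \ Metric.ball 0 (a n)).indicator
          (fun y => ENNReal.ofReal (f y * K y)) y := by
        refine lintegral_mono fun y => ?_
        by_cases hy : y ∈ E
        · rw [indicator_of_mem hy]
          rcases hcover y hy with h | ⟨n, h1, h2⟩
          · rw [ENNReal.ofReal_of_nonpos (mul_nonpos_of_nonpos_of_nonneg h (hK.nonneg y))]
            exact zero_le
          · refine le_trans ?_ (ENNReal.le_tsum n)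
            rw [indicator_of_mem]
            simpa using ⟨h2, h1⟩
        · rw [indicator_of_notMem hy]; exact zero_le
    _ = ∑' n, ∫⁻ y, (Metric.ball (0 : Space d) (2 * a n) \ Metric.ball 0 (a n)).indicator
          (fun y => ENNReal.ofReal (f y * K y)) y :=
        lintegral_tsum fun n => (hm.indicator (hA n)).aemeasurable
    _ ≤ ∑' n, ENNReal.ofReal (c n * (Lam * a n ^ (-(2 * s)))) := by
        refine ENNReal.tsum_le_tsum fun n => ?_
        rw [lintegral_indicator (hA n), ENNReal.ofReal_mul (hc n)]
        calc _ ≤ ∫⁻ y in Metric.ball (0 : Space d) (2 * a n) \ Metric.ball 0 (a n),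
              ENNReal.ofReal (c n) * ENNReal.ofReal (K y) := by
              refine setLIntegral_mono' (hA n) fun y hy => ?_
              rw [← ENNReal.ofReal_mul (hc n)]
              refine ENNReal.ofReal_le_ofReal (mul_le_mul_of_nonneg_right ?_ (hK.nonneg y))
              simp only [mem_sdiff, mem_ball_zero_iff, not_lt] at hy
              exact hbound n y hy.2 hy.1
          _ = ENNReal.ofReal (c n) * ∫⁻ y in Metric.ball (0 : Space d) (2 * a n) \
                Metric.ball 0 (a n), ENNReal.ofReal (K y) :=
              lintegral_const_mul _ hK.measurable.ennreal_ofReal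
          _ ≤ _ := by gcongr; exact hK.lintegral_annulus_le (ha n)

theorem tsum_ofReal_geometric {C q : ℝ} (hC : 0 ≤ C) (h0 : 0 ≤ q) (h1 : q < 1) :
    ∑' n : ℕ, ENNReal.ofReal (C * q ^ n) = ENNReal.ofReal (C / (1 - q)) := by
  rw [← ENNReal.ofReal_tsum_of_nonneg (fun n => by positivity)
    ((summable_geometric_of_lt_one h0 h1).mul_left C), tsum_mul_left,
    tsum_geometric_of_lt_one h0 h1, div_eq_mul_inv]

theorem two_pow_rpow (n : ℕ) (x : ℝ) : ((2 : ℝ) ^ n) ^ x = ((2 : ℝ) ^ x) ^ n := by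
  rw [← Real.rpow_natCast, ← Real.rpow_mul (by norm_num), mul_comm, Real.rpow_mul (by norm_num),
    Real.rpow_natCast]

/-- On the dyadic annuli shrinking to the origin the contributions form a geometric series of ratio
`2^(2s-p)`, convergent because `p > 2s`. The origin lies in no annulus, but the weight vanishes
there since `p ≠ 0`. -/
theorem IsAdmissibleKernel.lintegral_ball_le {d : ℕ} {s lam Lam ρ : ℝ} {K : Space d → ℝ}
    (hK : IsAdmissibleKernel d s lam Lam ρ K) (hLam : 0 < Lam) {p : ℕ} (hp : 2 * s < p)
    (hp0 : p ≠ 0) {r : ℝ} (hr : 0 < r) :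
    ∫⁻ y in Metric.ball (0 : Space d) r, ENNReal.ofReal ((‖y‖ / r) ^ p * K y)
      ≤ ENNReal.ofReal (Lam * 2 ^ (2 * s) / (1 - 2 ^ (2 * s - p)) * r ^ (-(2 * s))) := by
  refine (hK.lintegral_weight_le_tsum (a := fun n => r / 2 ^ (n + 1))
    (c := fun n => ((1 / 2 : ℝ) ^ n) ^ p) (by fun_prop) measurableSet_ball
    (fun n => by positivity) (fun n => by positivity) ?_ ?_).trans (le_of_eq ?_)
  · intro y hy
    rw [mem_ball_zero_iff] at hy
    rcases (norm_nonneg y).eq_or_lt with h | h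
    · left; simp [← h, hp0]
    right
    obtain ⟨n, h1, h2⟩ := exists_mem_Ico_zpow (div_pos h hr) one_lt_two
    have hn : n < 0 := by
      by_contra! hn
      have : (1 : ℝ) ≤ 2 ^ n := one_le_zpow₀ one_le_two hn
      have := this.trans h1
      rw [one_le_div hr] at this
      linarith
    obtain ⟨k, rfl⟩ : ∃ k : ℕ, n = -((k : ℤ) + 1) := ⟨(-n - 1).toNat, by lia⟩
    refine ⟨k, ?_, ?_⟩
    · rw [le_div_iff₀ hr, zpow_neg] at h1
      rw [div_eq_inv_mul]
      exact_mod_cast h1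
    · rw [div_lt_iff₀ hr, zpow_add₀ two_ne_zero, zpow_neg] at h2
      rw [div_eq_inv_mul, ← mul_assoc]
      rw [mul_comm (2 : ℝ)]
      exact_mod_cast h2
  · intro n y _ h2
    have : ‖y‖ / r ≤ (1 / 2) ^ n := by
      rw [div_le_iff₀ hr]
      refine h2.le.trans (le_of_eq ?_)
      rw [pow_succ, one_div, inv_pow]; field_simp
    gcongr
  · rw [show Lam * 2 ^ (2 * s) / (1 - 2 ^ (2 * s - p)) * r ^ (-(2 * s))
        = (Lam * 2 ^ (2 * s) * r ^ (-(2 * s))) / (1 - 2 ^ (2 * s - p)) by ring,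
      ← tsum_ofReal_geometric (by positivity) (by positivity)
        (Real.rpow_lt_one_of_one_lt_of_neg one_lt_two (by linarith))]
    congr 1; ext n; congr 1
    rw [Real.div_rpow hr.le (by positivity), two_pow_rpow, Real.rpow_sub two_pos,
      Real.rpow_neg two_pos.le, Real.rpow_natCast, one_div, inv_pow, pow_succ, div_pow, inv_pow,
      ← pow_mul, ← pow_mul, mul_comm n p]
    field_simp
    rw [← mul_pow, one_div_mul_cancel (by positivity), one_pow]

/-- The counterpart at infinity: on growing dyadic annuli the ratio is `2^(p-2s)`, so growth of
order `p < 2s` is allowed. -/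
theorem IsAdmissibleKernel.lintegral_compl_ball_le {d : ℕ} {s lam Lam ρ : ℝ} {K : Space d → ℝ}
    (hK : IsAdmissibleKernel d s lam Lam ρ K) (hLam : 0 < Lam) {p : ℕ} (hp : p < 2 * s)
    {r : ℝ} (hr : 0 < r) :
    ∫⁻ y in (Metric.ball (0 : Space d) r)ᶜ, ENNReal.ofReal ((‖y‖ / r) ^ p * K y)
      ≤ ENNReal.ofReal (Lam * 2 ^ p / (1 - 2 ^ (p - 2 * s)) * r ^ (-(2 * s))) := by
  refine (hK.lintegral_weight_le_tsum (a := fun n => r * 2 ^ n)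
    (c := fun n => ((2 : ℝ) ^ (n + 1)) ^ p) (by fun_prop) measurableSet_ball.compl
    (fun n => by positivity) (fun n => by positivity) ?_ ?_).trans (le_of_eq ?_)
  · intro y hy
    rw [mem_compl_iff, mem_ball_zero_iff, not_lt] at hy
    right
    obtain ⟨n, h1, h2⟩ := exists_nat_pow_near ((one_le_div hr).2 hy) one_lt_two
    rw [le_div_iff₀ hr] at h1
    rw [div_lt_iff₀ hr, pow_succ] at h2
    exact ⟨n, by linarith, by linarith⟩
  · intro n y _ h2
    have : ‖y‖ / r ≤ 2 ^ (n + 1) := by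
      rw [div_le_iff₀ hr]
      refine h2.le.trans (le_of_eq ?_)
      ring
    gcongr
  · rw [show Lam * 2 ^ p / (1 - 2 ^ (p - 2 * s)) * r ^ (-(2 * s))
        = (Lam * 2 ^ p * r ^ (-(2 * s))) / (1 - 2 ^ (p - 2 * s)) by ring,
      ← tsum_ofReal_geometric (by positivity) (by positivity)
        (Real.rpow_lt_one_of_one_lt_of_neg one_lt_two (by linarith))]
    congr 1; ext n; congr 1
    rw [Real.mul_rpow hr.le (by positivity), two_pow_rpow, Real.rpow_sub two_pos,
      Real.rpow_neg two_pos.le, Real.rpow_natCast, pow_succ, div_pow, mul_pow, inv_pow,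
      ← pow_mul, ← pow_mul, mul_comm n p]
    field_simp

/-- Decay exponent at the origin of the compensated differences of a smooth function. -/
noncomputable def nearExp (s : ℝ) : ℕ := if s < 1 / 2 then 1 else 2

/-- Growth exponent at infinity of the compensated differences of a smooth function. -/
noncomputable def farExp (s : ℝ) : ℕ := if 1 / 2 < s then 1 else 0

/-- The model bound for compensated differences at scale `r`. -/
noncomputable def kernelWeight {d : ℕ} (s r : ℝ) (y : Space d) : ℝ :=
  if ‖y‖ < r then (‖y‖ / r) ^ nearExp s else (‖y‖ / r) ^ farExp s

theorem kernelWeight_nonneg {d : ℕ} {s r : ℝ} (hr : 0 < r) (y : Space d) :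
    0 ≤ kernelWeight s r y := by
  unfold kernelWeight; split_ifs <;> positivity

theorem one_le_kernelWeight {d : ℕ} {s r : ℝ} (hr : 0 < r) {y : Space d} (hy : r ≤ ‖y‖) :
    1 ≤ kernelWeight s r y := by
  rw [kernelWeight, if_neg hy.not_gt]
  exact one_le_pow₀ ((one_le_div hr).2 hy)

theorem measurable_kernelWeight {d : ℕ} (s r : ℝ) :
    Measurable (kernelWeight s r : Space d → ℝ) :=
  Measurable.ite (measurableSet_lt measurable_norm measurable_const) (by fun_prop) (by fun_prop)

theorem lt_nearExp {s : ℝ} (hs1 : s < 1) : 2 * s < nearExp s := by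
  unfold nearExp; split_ifs <;> push_cast <;> linarith

theorem farExp_lt {s : ℝ} (hs0 : 0 < s) : (farExp s : ℝ) < 2 * s := by
  unfold farExp; split_ifs <;> push_cast <;> linarith

/-- The weight is integrable against admissible kernels, with the scaling of `L_K`. -/
theorem exists_kernelWeight_bound (d : ℕ) {s Lam : ℝ} (hs0 : 0 < s) (hs1 : s < 1)
    (hLam : 0 < Lam) :
    ∃ C : ℝ, 0 < C ∧ ∀ (lam ρ : ℝ) (K : Space d → ℝ), IsAdmissibleKernel d s lam Lam ρ K →
      ∀ r : ℝ, 0 < r → Integrable (fun y => kernelWeight s r y * K y) ∧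
        ∫ y, kernelWeight s r y * K y ≤ C * r ^ (-(2 * s)) := by
  have h1 : (2 : ℝ) ^ (2 * s - nearExp s) < 1 :=
    Real.rpow_lt_one_of_one_lt_of_neg one_lt_two (by linarith [lt_nearExp hs1])
  have h2 : (2 : ℝ) ^ (farExp s - 2 * s) < 1 :=
    Real.rpow_lt_one_of_one_lt_of_neg one_lt_two (by linarith [farExp_lt hs0])
  set C1 := Lam * 2 ^ (2 * s) / (1 - 2 ^ (2 * s - nearExp s)) with hC1
  set C2 := Lam * 2 ^ (farExp s) / (1 - 2 ^ (farExp s - 2 * s)) with hC2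
  have hC1p : 0 < C1 := div_pos (by positivity) (by linarith)
  have hC2p : 0 < C2 := div_pos (by positivity) (by linarith)
  refine ⟨C1 + C2, by positivity, fun lam ρ K hK r hr => ?_⟩
  have hp0 : nearExp s ≠ 0 := by unfold nearExp; split_ifs <;> norm_num
  have hnn : ∀ y, 0 ≤ kernelWeight s r y * K y := fun y =>
    mul_nonneg (kernelWeight_nonneg hr y) (hK.nonneg y)
  have hmeas : Measurable fun y => kernelWeight s r y * K y :=
    (measurable_kernelWeight s r).mul hK.measurable
  have hle : ∫⁻ y, ENNReal.ofReal (kernelWeight s r y * K y)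
      ≤ ENNReal.ofReal ((C1 + C2) * r ^ (-(2 * s))) := by
    rw [← lintegral_add_compl _ (measurableSet_ball (x := (0 : Space d)) (ε := r)), add_mul,
      ENNReal.ofReal_add (by positivity) (by positivity)]
    refine add_le_add ?_ ?_
    · refine le_trans (le_of_eq (setLIntegral_congr_fun measurableSet_ball fun y hy => ?_))
        (hK.lintegral_ball_le hLam (lt_nearExp hs1) hp0 hr)
      rw [mem_ball_zero_iff] at hy
      simp [kernelWeight, hy]
    · refine le_trans (le_of_eq (setLIntegral_congr_fun measurableSet_ball.compl fun y hy => ?_))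
        (hK.lintegral_compl_ball_le hLam (farExp_lt hs0) hr)
      rw [mem_compl_iff, mem_ball_zero_iff] at hy
      simp [kernelWeight, hy]
  refine ⟨⟨hmeas.aestronglyMeasurable, ?_⟩, ?_⟩
  · rw [hasFiniteIntegral_iff_ofReal (ae_of_all _ hnn)]
    exact hle.trans_lt ENNReal.ofReal_lt_top
  · rw [integral_eq_lintegral_of_nonneg_ae (ae_of_all _ hnn) hmeas.aestronglyMeasurable]
    exact ENNReal.toReal_le_of_le_ofReal (by positivity) hle

/-- At scales `a ≥ ρ` the truncation at `ρ` is invisible, both entries of the minimum being at least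
`a^(-d-2s)`. All nondegeneracy enters through this bound, which is why the iteration stops at scale
`ρ`. -/
theorem IsAdmissibleKernel.lower_of_norm_le {d : ℕ} {s lam Lam ρ : ℝ} {K : Space d → ℝ}
    (hK : IsAdmissibleKernel d s lam Lam ρ K) (hs0 : 0 < s) (hlam : 0 < lam) (hρ : 0 ≤ ρ)
    {a : ℝ} (hρa : ρ ≤ a) {y : Space d} (hy : y ≠ 0) (hya : ‖y‖ ≤ a) :
    lam * a ^ (-(d : ℝ) - 2 * s) ≤ K y := by
  refine le_trans (mul_le_mul_of_nonneg_left ?_ hlam.le) (hK.lower y hy)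
  have hd : (0 : ℝ) ≤ d := d.cast_nonneg
  have h1 : a ^ (-(d : ℝ) - 2 * s) ≤ ‖y‖ ^ (-(d : ℝ) - 2 * s) :=
    Real.rpow_le_rpow_of_nonpos (norm_pos_iff.2 hy) hya (by linarith)
  unfold lowerKernel
  split_ifs with h
  · exact h1
  · exact le_min h1 (Real.rpow_le_rpow_of_nonpos (lt_of_le_of_ne hρ (Ne.symm h)) hρa (by linarith))

/-! ### Compensated differences and the choice of the compensation radius -/

/-- The difference operator with gradient `g` and compensation radius `r` if `s = 1/2`. -/
noncomputable def compDiff {d : ℕ} (s r : ℝ) (w : Space d → ℝ) (g x y : Space d) : ℝ :=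
  if s < 1 / 2 then w (x + y) - w x
  else if s = 1 / 2 then w (x + y) - w x - (if ‖y‖ < r then inner ℝ y g else 0)
  else w (x + y) - w x - inner ℝ y g

theorem diffOp_eq_compDiff {d : ℕ} (s : ℝ) (w : Space d → ℝ) (x y : Space d) :
    diffOp s w x y = compDiff s 1 w (gradient w x) x y := by
  simp only [diffOp, compDiff, mem_ball_zero_iff]

theorem IsAdmissibleKernel.integral_annulus_inner {d : ℕ} {s lam Lam ρ : ℝ} {K : Space d → ℝ}
    (hK : IsAdmissibleKernel d s lam Lam ρ K) (hs : s = 1 / 2) (g : Space d) {r : ℝ}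
    (hr : 0 < r) :
    Integrable (fun y => ((if ‖y‖ < 2 * r then inner ℝ y g else 0) -
        (if ‖y‖ < r then inner ℝ y g else 0)) * K y) ∧
      ∫ y, ((if ‖y‖ < 2 * r then inner ℝ y g else 0) -
        (if ‖y‖ < r then inner ℝ y g else 0)) * K y = 0 := by
  have hA : MeasurableSet (Metric.ball (0 : Space d) (2 * r) \ Metric.ball 0 r) :=
    measurableSet_ball.diff measurableSet_ball
  have heq : (fun y : Space d => ((if ‖y‖ < 2 * r then inner ℝ y g else 0) -
        (if ‖y‖ < r then inner ℝ y g else 0)) * K y) =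
      (Metric.ball (0 : Space d) (2 * r) \ Metric.ball 0 r).indicator
        (fun y => inner ℝ g (K y • y)) := by
    ext y
    by_cases h1 : ‖y‖ < r
    · have h2 : ‖y‖ < 2 * r := by linarith
      simp [h1, h2]
    · by_cases h2 : ‖y‖ < 2 * r
      · simp only [h2, h1, if_true, if_false, sub_zero]
        rw [indicator_of_mem (by simpa using ⟨h2, not_lt.1 h1⟩), inner_smul_right,
          real_inner_comm, mul_comm]
      · simp [h1, h2]
  have hint : IntegrableOn (fun y => K y • y)
      (Metric.ball (0 : Space d) (2 * r) \ Metric.ball 0 r) := by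
    refine Integrable.mono' ((hK.integrableOn r hr).mul_const (2 * r))
      (hK.measurable.smul measurable_id).aestronglyMeasurable ?_
    refine (ae_restrict_iff' hA).2 (ae_of_all _ fun y hy => ?_)
    simp only [mem_sdiff, mem_ball_zero_iff] at hy
    rw [norm_smul, Real.norm_of_nonneg (hK.nonneg y)]
    exact mul_le_mul_of_nonneg_left hy.1.le (hK.nonneg y)
  rw [heq]
  refine ⟨(integrable_indicator_iff hA).2 (hint.const_inner g), ?_⟩
  rw [integral_indicator hA, integral_inner hint, hK.symm hs r hr, inner_zero_right]

/-- The cutoffs at radii `1` and `2^n` differ by finitely many annuli with outer radius twice the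
inner one, and each has zero first moment. The telescoping reaches only powers of two, hence the
dyadic radii in the growth lemma and the iteration. -/
theorem IsAdmissibleKernel.integral_cutoff_inner {d : ℕ} {s lam Lam ρ : ℝ} {K : Space d → ℝ}
    (hK : IsAdmissibleKernel d s lam Lam ρ K) (hs : s = 1 / 2) (g : Space d) (n : ℤ) :
    Integrable (fun y => ((if ‖y‖ < (2 : ℝ) ^ n then inner ℝ y g else 0) -
        (if ‖y‖ < 1 then inner ℝ y g else 0)) * K y) ∧
      ∫ y, ((if ‖y‖ < (2 : ℝ) ^ n then inner ℝ y g else 0) -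
        (if ‖y‖ < 1 then inner ℝ y g else 0)) * K y = 0 := by
  induction n using Int.induction_on with
  | zero => simp
  | succ i ih =>
    have h := hK.integral_annulus_inner hs g (r := (2 : ℝ) ^ (i : ℤ)) (by positivity)
    rw [show (2 : ℝ) * 2 ^ (i : ℤ) = 2 ^ ((i : ℤ) + 1) by rw [zpow_add₀ two_ne_zero]; ring] at h
    have heq := fun y : Space d => show
      ((if ‖y‖ < (2 : ℝ) ^ ((i : ℤ) + 1) then inner ℝ y g else 0) -
        (if ‖y‖ < 1 then inner ℝ y g else 0)) * K y = _ + _ from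
      (by ring : _ = ((if ‖y‖ < (2 : ℝ) ^ ((i : ℤ) + 1) then inner ℝ y g else 0) -
        (if ‖y‖ < (2 : ℝ) ^ (i : ℤ) then inner ℝ y g else 0)) * K y +
        ((if ‖y‖ < (2 : ℝ) ^ (i : ℤ) then inner ℝ y g else 0) -
        (if ‖y‖ < 1 then inner ℝ y g else 0)) * K y)
    simp_rw [heq]
    exact ⟨h.1.add ih.1, by rw [integral_add h.1 ih.1, h.2, ih.2, add_zero]⟩
  | pred i ih =>
    have h := hK.integral_annulus_inner hs g (r := (2 : ℝ) ^ (-(i : ℤ) - 1)) (by positivity)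
    rw [show (2 : ℝ) * 2 ^ (-(i : ℤ) - 1) = 2 ^ (-(i : ℤ)) by
      rw [zpow_sub₀ two_ne_zero]; simp; ring] at h
    have heq := fun y : Space d => show
      ((if ‖y‖ < (2 : ℝ) ^ (-(i : ℤ) - 1) then inner ℝ y g else 0) -
        (if ‖y‖ < 1 then inner ℝ y g else 0)) * K y = _ - _ from
      (by ring : _ = ((if ‖y‖ < (2 : ℝ) ^ (-(i : ℤ)) then inner ℝ y g else 0) -
        (if ‖y‖ < 1 then inner ℝ y g else 0)) * K y -
        ((if ‖y‖ < (2 : ℝ) ^ (-(i : ℤ)) then inner ℝ y g else 0) -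
        (if ‖y‖ < (2 : ℝ) ^ (-(i : ℤ) - 1) then inner ℝ y g else 0)) * K y)
    simp_rw [heq]
    exact ⟨ih.1.sub h.1, by rw [integral_sub ih.1 h.1, h.2, ih.2, sub_zero]⟩

/-- At dyadic radii the compensation radius is immaterial. -/
theorem IsAdmissibleKernel.nonlocalOp_eq {d : ℕ} {s lam Lam ρ : ℝ} {K : Space d → ℝ}
    (hK : IsAdmissibleKernel d s lam Lam ρ K) (n : ℤ) (w : Space d → ℝ) (x : Space d)
    (hint : Integrable fun y => compDiff s ((2 : ℝ) ^ n) w (gradient w x) x y * K y) :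
    nonlocalOp s K w x = ∫ y, compDiff s ((2 : ℝ) ^ n) w (gradient w x) x y * K y := by
  unfold nonlocalOp
  simp_rw [diffOp_eq_compDiff]
  by_cases hs : s = 1 / 2
  · have h := hK.integral_cutoff_inner hs (gradient w x) n
    have heq : ∀ y, compDiff s 1 w (gradient w x) x y * K y =
        compDiff s ((2 : ℝ) ^ n) w (gradient w x) x y * K y +
        ((if ‖y‖ < (2 : ℝ) ^ n then inner ℝ y (gradient w x) else 0) -
          (if ‖y‖ < 1 then inner ℝ y (gradient w x) else 0)) * K y := by
      intro y
      have : ¬ s < 1 / 2 := by rw [hs]; exact lt_irrefl _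
      simp only [compDiff, if_neg this, if_pos hs]
      ring
    simp_rw [heq]
    rw [integral_add hint h.1, h.2, add_zero]
  · simp only [compDiff, if_neg hs]

theorem compDiff_sub {d : ℕ} {s r : ℝ} {v w : Space d → ℝ} {g x y : Space d} (h : v x = w x) :
    compDiff s r v g x y = compDiff s r w g x y + (v (x + y) - w (x + y)) := by
  unfold compDiff
  split_ifs <;> rw [h] <;> ring

theorem compDiff_const_sub_mul {d : ℕ} (s r c m : ℝ) (w : Space d → ℝ) (g x y : Space d) :
    compDiff s r (fun z => c - m * w z) (-(m • g)) x y = -(m * compDiff s r w g x y) := by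
  unfold compDiff
  simp only [inner_neg_right, inner_smul_right]
  split_ifs <;> ring

/-- A bounded function with a second order expansion at `x` has integrable differences. -/
theorem IsAdmissibleKernel.integrable_compDiff {d : ℕ} {s lam Lam ρ : ℝ} {K : Space d → ℝ}
    (hs0 : 0 < s) (hs1 : s < 1) (hLam : 0 < Lam)
    (hK : IsAdmissibleKernel d s lam Lam ρ K) {v : Space d → ℝ}
    (hv : AEStronglyMeasurable v) {M ε r : ℝ} (hM : 0 ≤ M) (hε : 0 < ε) (hεr : ε ≤ r)
    {g x : Space d} (hnear : ∀ y, ‖y‖ < ε → |v (x + y) - v x - inner ℝ y g| ≤ M * ‖y‖ ^ 2)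
    (hbdd : ∀ᵐ z, |v z| ≤ M) :
    Integrable fun y => compDiff s r v g x y * K y := by
  obtain ⟨C, -, hC⟩ := exists_kernelWeight_bound d hs0 hs1 hLam
  have hmp : MeasurePreserving (fun y : Space d => x + y) volume volume :=
    measurePreserving_add_left volume x
  have hvx : AEStronglyMeasurable fun y => v (x + y) := hv.comp_measurePreserving hmp
  have hbx : ∀ᵐ y, |v (x + y)| ≤ M := hmp.quasiMeasurePreserving.ae hbdd
  refine Integrable.mono' (((hC lam ρ K hK ε hε).1).const_mul
    (M * ε ^ 2 + ε * ‖g‖ + M + |v x| + r * ‖g‖)) ?_ ?_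
  · refine AEStronglyMeasurable.mul ?_ hK.measurable.aestronglyMeasurable
    have h1 : AEStronglyMeasurable (fun y => v (x + y) - v x) :=
      hvx.sub aestronglyMeasurable_const
    have h2 : Measurable fun y : Space d => (inner ℝ y g : ℝ) := by fun_prop
    unfold compDiff
    split_ifs
    · exact h1
    · exact h1.sub (Measurable.ite (measurableSet_lt measurable_norm measurable_const) h2
        measurable_const).aestronglyMeasurable
    · exact h1.sub h2.aestronglyMeasurable
  · filter_upwards [hbx] with y hy
    rw [norm_mul, Real.norm_of_nonneg (hK.nonneg y), ← mul_assoc, Real.norm_eq_abs]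
    refine mul_le_mul_of_nonneg_right ?_ (hK.nonneg y)
    have hg0 := norm_nonneg g
    have hv0 := abs_nonneg (v x)
    have hy0 := norm_nonneg y
    have hin : |inner ℝ y g| ≤ ‖y‖ * ‖g‖ := abs_real_inner_le_norm y g
    have hr0 : 0 < r := hε.trans_le hεr
    have hd0 : |v (x + y) - v x| ≤ M + |v x| := (abs_sub _ _).trans (by linarith)
    by_cases hyε : ‖y‖ < ε
    · have hn := hnear y hyε
      simp only [kernelWeight, hyε, if_true, nearExp]
      set t := ‖y‖ / ε with ht
      have hyt : ‖y‖ = ε * t := by rw [ht]; field_simp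
      have ht0 : 0 ≤ t := by positivity
      have ht1 : t ≤ 1 := by rw [ht, div_le_one hε]; exact hyε.le
      have hrest : 0 ≤ M + |v x| + r * ‖g‖ := by positivity
      by_cases h1 : s < 1 / 2
      · simp only [compDiff, h1, if_true, pow_one]
        calc |v (x + y) - v x| ≤ M * ‖y‖ ^ 2 + ‖y‖ * ‖g‖ := by
              have := abs_add_le (v (x + y) - v x - inner ℝ y g) (inner ℝ y g)
              rw [sub_add_cancel] at this
              linarith
          _ ≤ (M * ε ^ 2 + ε * ‖g‖) * t := by
              rw [hyt]
              have : M * ε ^ 2 * t ^ 2 ≤ M * ε ^ 2 * t :=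
                mul_le_mul_of_nonneg_left (by nlinarith) (by positivity)
              nlinarith
          _ ≤ _ := mul_le_mul_of_nonneg_right (by linarith) ht0
      · have hc : compDiff s r v g x y = v (x + y) - v x - inner ℝ y g := by
          simp only [compDiff, if_neg h1, if_pos (hyε.trans_le hεr), ite_self]
        simp only [hc, h1, if_false]
        calc _ ≤ M * ‖y‖ ^ 2 := hn
          _ = M * ε ^ 2 * t ^ 2 := by rw [hyt]; ring
          _ ≤ _ := mul_le_mul_of_nonneg_right (by nlinarith) (by positivity)
    · have hyε' := not_lt.1 hyε
      have hw := one_le_kernelWeight (s := s) hε hyε'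
      have hC0 : 0 ≤ M * ε ^ 2 + ε * ‖g‖ := by positivity
      -- Away from the origin the difference is bounded if `s ≤ 1/2`, where the weight is `1`. If `s
      -- > 1/2`, the gradient term is never cut off and its linear growth is matched by the weight
      -- `‖y‖ / ε`.
      have key : |compDiff s r v g x y| ≤ M + |v x| + r * ‖g‖ ∨ 1 / 2 < s := by
        by_cases h2 : 1 / 2 < s
        · exact Or.inr h2
        · left
          unfold compDiff
          split_ifs with h3 h4 h5
          · exact hd0.trans (by nlinarith)
          · refine (abs_sub _ _).trans ?_
            nlinarith
          · simp only [sub_zero]; exact hd0.trans (by nlinarith)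
          · exact absurd (lt_of_le_of_ne (not_lt.1 h3) (Ne.symm h4)) h2
      rcases key with h | h
      · have : 0 ≤ M + |v x| + r * ‖g‖ := by positivity
        calc _ ≤ M * ε ^ 2 + ε * ‖g‖ + M + |v x| + r * ‖g‖ := by linarith
          _ ≤ _ := le_mul_of_one_le_right (by linarith) hw
      · have hwt : kernelWeight s ε y = ‖y‖ / ε := by
          rw [kernelWeight, if_neg hyε, farExp, if_pos h, pow_one]
        rw [hwt] at hw ⊢
        have hc : compDiff s r v g x y = v (x + y) - v x - inner ℝ y g := by
          rw [compDiff, if_neg h.not_gt, if_neg h.ne']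
        rw [hc]
        have hyt : ‖y‖ = ε * (‖y‖ / ε) := by field_simp
        set t := ‖y‖ / ε
        calc |v (x + y) - v x - inner ℝ y g| ≤ (M + |v x|) + ‖y‖ * ‖g‖ :=
              (abs_sub _ _).trans (by linarith)
          _ ≤ (M + |v x|) * t + ε * ‖g‖ * t := by rw [hyt]; nlinarith
          _ ≤ _ := by rw [← add_mul]; exact mul_le_mul_of_nonneg_right (by
              have : 0 ≤ M * ε ^ 2 := by positivity
              have : 0 ≤ r * ‖g‖ := by positivity
              linarith) (by linarith)

/-! ### The bump function -/

/-- The square root of the bump function. -/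
noncomputable def bumpRoot {d : ℕ} (c : Space d) (r : ℝ) (x : Space d) : ℝ :=
  max 0 (1 - ‖x - c‖ ^ 2 / (4 * r ^ 2))

/-- A `C^{1,1}` bump supported in the ball of radius `2 * r`. -/
noncomputable def bump {d : ℕ} (c : Space d) (r : ℝ) (x : Space d) : ℝ :=
  bumpRoot c r x ^ 2

/-- The gradient of the bump. -/
noncomputable def bumpGrad {d : ℕ} (c : Space d) (r : ℝ) (x : Space d) : Space d :=
  (-(bumpRoot c r x / r ^ 2)) • (x - c)

theorem bumpRoot_nonneg {d : ℕ} (c : Space d) (r : ℝ) (x : Space d) : 0 ≤ bumpRoot c r x :=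
  le_max_left _ _

theorem bumpRoot_le_one {d : ℕ} (c : Space d) (r : ℝ) (x : Space d) : bumpRoot c r x ≤ 1 :=
  max_le zero_le_one (by linarith [show 0 ≤ ‖x - c‖ ^ 2 / (4 * r ^ 2) by positivity])

theorem bump_nonneg {d : ℕ} (c : Space d) (r : ℝ) (x : Space d) : 0 ≤ bump c r x := sq_nonneg _

theorem bump_le_one {d : ℕ} (c : Space d) (r : ℝ) (x : Space d) : bump c r x ≤ 1 :=
  pow_le_one₀ (bumpRoot_nonneg c r x) (bumpRoot_le_one c r x)

theorem continuous_bump {d : ℕ} (c : Space d) (r : ℝ) : Continuous (bump c r) := by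
  unfold bump bumpRoot; fun_prop

theorem bumpRoot_eq {d : ℕ} {c : Space d} {r : ℝ} {x : Space d} (hx : ‖x - c‖ ≤ 2 * r) :
    bumpRoot c r x = 1 - ‖x - c‖ ^ 2 / (4 * r ^ 2) := by
  refine max_eq_right ?_
  rw [sub_nonneg]
  refine div_le_one_of_le₀ ?_ (by positivity)
  calc ‖x - c‖ ^ 2 ≤ (2 * r) ^ 2 := by gcongr
    _ = _ := by ring

theorem bump_eq_zero {d : ℕ} {c : Space d} {r : ℝ} (hr : 0 < r) {x : Space d}
    (hx : 2 * r ≤ ‖x - c‖) : bump c r x = 0 := by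
  have : bumpRoot c r x = 0 := by
    refine max_eq_left ?_
    rw [sub_nonpos, one_le_div (by positivity)]
    calc 4 * r ^ 2 = (2 * r) ^ 2 := by ring
      _ ≤ _ := by gcongr
  rw [bump, this]; norm_num

theorem le_bumpRoot {d : ℕ} {c : Space d} {r θ : ℝ} (hr : 0 < r) {x : Space d}
    (hx : ‖x - c‖ ≤ θ * r) : 1 - θ ^ 2 / 4 ≤ bumpRoot c r x := by
  refine le_trans ?_ (le_max_right _ _)
  have : ‖x - c‖ ^ 2 / (4 * r ^ 2) ≤ θ ^ 2 / 4 := by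
    rw [div_le_div_iff₀ (by positivity) (by norm_num)]
    have : ‖x - c‖ ^ 2 ≤ (θ * r) ^ 2 := by gcongr
    linarith
  linarith

theorem bump_add_expansion {d : ℕ} (c : Space d) {r : ℝ} (x y : Space d) :
    (1 - ‖x + y - c‖ ^ 2 / (4 * r ^ 2)) = 1 - ‖x - c‖ ^ 2 / (4 * r ^ 2) -
      (2 * inner ℝ y (x - c) + ‖y‖ ^ 2) / (4 * r ^ 2) := by
  rw [show x + y - c = (x - c) + y by abel, norm_add_sq_real, real_inner_comm]
  ring

/-- Convexity: with `p` the root at `x`, every real `t` satisfies `(max 0 t)^2 ≥ p^2 + 2p(t - p)`.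
The error therefore carries a factor `p = √b`, which is what the damping needs, instead of being of
order one. -/
theorem bump_sub_ge {d : ℕ} {c : Space d} {r : ℝ} (hr : 0 < r) {x : Space d}
    (hx : ‖x - c‖ ≤ 2 * r) (y : Space d) :
    -(bumpRoot c r x * (‖y‖ / r) ^ 2 / 2)
      ≤ bump c r (x + y) - bump c r x - inner ℝ y (bumpGrad c r x) := by
  have hp := bumpRoot_nonneg c r x
  have h1 : bumpRoot c r x ^ 2 + 2 * bumpRoot c r x *
      ((1 - ‖x + y - c‖ ^ 2 / (4 * r ^ 2)) - bumpRoot c r x) ≤ bump c r (x + y) := by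
    unfold bump
    rw [bumpRoot.eq_def c r (x + y)]
    set t := 1 - ‖x + y - c‖ ^ 2 / (4 * r ^ 2)
    rcases le_total t 0 with h | h
    · rw [max_eq_left h]; nlinarith
    · rw [max_eq_right h]; nlinarith [sq_nonneg (t - bumpRoot c r x)]
  rw [bump_add_expansion, ← bumpRoot_eq hx] at h1
  rw [bumpGrad, inner_smul_right, bump.eq_def c r x]
  refine le_trans (le_of_eq ?_) (sub_le_sub_right (sub_le_sub_right h1 _) _)
  field_simp
  ring

theorem bump_sub_le {d : ℕ} {c : Space d} {r : ℝ} (hr : 0 < r) {x : Space d}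
    (hx : ‖x - c‖ ≤ 2 * r) {y : Space d} (hy : ‖y‖ ≤ r) :
    bump c r (x + y) - bump c r x - inner ℝ y (bumpGrad c r x) ≤ 2 / r ^ 2 * ‖y‖ ^ 2 := by
  have h1 : bump c r (x + y) ≤ (1 - ‖x + y - c‖ ^ 2 / (4 * r ^ 2)) ^ 2 := by
    unfold bump bumpRoot
    set t := 1 - ‖x + y - c‖ ^ 2 / (4 * r ^ 2)
    rcases le_total t 0 with h | h
    · rw [max_eq_left h]; nlinarith
    · rw [max_eq_right h]
  rw [bump_add_expansion, ← bumpRoot_eq hx] at h1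
  rw [bumpGrad, inner_smul_right, bump.eq_def c r x]
  have hin : |inner ℝ y (x - c)| ≤ ‖y‖ * (2 * r) :=
    (abs_real_inner_le_norm y (x - c)).trans (by gcongr)
  set I : ℝ := inner ℝ y (x - c)
  set p := bumpRoot c r x
  have hp := bumpRoot_nonneg c r x
  have hn := norm_nonneg y
  have h2 : (2 * I + ‖y‖ ^ 2) ^ 2 ≤ (5 * r * ‖y‖) ^ 2 := by
    refine sq_le_sq' ?_ ?_ <;> nlinarith [abs_le.1 hin]
  have h3 : ((2 * I + ‖y‖ ^ 2) / (4 * r ^ 2)) ^ 2 ≤ 25 / 16 / r ^ 2 * ‖y‖ ^ 2 := by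
    rw [div_pow, div_le_iff₀ (by positivity)]
    refine h2.trans (le_of_eq ?_)
    field_simp
    ring
  have h4 : (p - (2 * I + ‖y‖ ^ 2) / (4 * r ^ 2)) ^ 2 - p ^ 2 - -(p / r ^ 2) * I
      = ((2 * I + ‖y‖ ^ 2) / (4 * r ^ 2)) ^ 2 - p * ‖y‖ ^ 2 / (2 * r ^ 2) := by
    field_simp
    ring
  have h5 : 0 ≤ p * ‖y‖ ^ 2 / (2 * r ^ 2) := by positivity
  have h6 : 25 / 16 / r ^ 2 * ‖y‖ ^ 2 ≤ 2 / r ^ 2 * ‖y‖ ^ 2 := by gcongr; norm_num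
  linarith

theorem norm_bumpGrad_le {d : ℕ} {c : Space d} {r : ℝ} (hr : 0 < r) {x : Space d}
    (hx : ‖x - c‖ ≤ 2 * r) : ‖bumpGrad c r x‖ ≤ 2 * bumpRoot c r x / r := by
  have hp := bumpRoot_nonneg c r x
  rw [bumpGrad, norm_smul, norm_neg, Real.norm_of_nonneg (by positivity)]
  calc _ ≤ bumpRoot c r x / r ^ 2 * (2 * r) := by gcongr
    _ = _ := by field_simp

theorem abs_bump_sub_le {d : ℕ} {c : Space d} {r : ℝ} (hr : 0 < r) {x : Space d}
    (hx : ‖x - c‖ ≤ 2 * r) {y : Space d} (hy : ‖y‖ ≤ r) :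
    |bump c r (x + y) - bump c r x - inner ℝ y (bumpGrad c r x)| ≤ 2 / r ^ 2 * ‖y‖ ^ 2 := by
  refine abs_le.2 ⟨le_trans ?_ (bump_sub_ge hr hx y), bump_sub_le hr hx hy⟩
  rw [neg_le_neg_iff, div_pow]
  have := bumpRoot_le_one c r x
  have h0 := bumpRoot_nonneg c r x
  have h3 : 0 ≤ ‖y‖ ^ 2 / r ^ 2 := by positivity
  calc _ ≤ 1 * (‖y‖ ^ 2 / r ^ 2) / 2 := by gcongr
    _ ≤ 2 * (‖y‖ ^ 2 / r ^ 2) := by linarith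
    _ = _ := by ring

theorem hasGradientAt_bump {d : ℕ} {c : Space d} {r : ℝ} (hr : 0 < r) {x : Space d}
    (hx : ‖x - c‖ < 2 * r) : HasGradientAt (bump c r) (bumpGrad c r x) x := by
  rw [hasGradientAt_iff_isLittleO]
  refine Asymptotics.IsBigO.trans_isLittleO (g := fun z : Space d => ‖z - x‖ ^ 2)
    (Asymptotics.IsBigO.of_bound (2 / r ^ 2) ?_) ?_
  · filter_upwards [Metric.ball_mem_nhds x hr] with z hz
    rw [mem_ball_iff_norm] at hz
    have h1 := abs_bump_sub_le hr hx.le (y := z - x) hz.le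
    rw [add_sub_cancel] at h1
    rwa [real_inner_comm, Real.norm_eq_abs, Real.norm_of_nonneg (by positivity)]
  · simpa using Asymptotics.isLittleO_pow_sub_sub x (m := 2) one_lt_two

theorem hasGradientAt_const_sub_mul_bump {d : ℕ} (a m : ℝ) {c : Space d} {r : ℝ} (hr : 0 < r)
    {x : Space d} (hx : ‖x - c‖ < 2 * r) :
    HasGradientAt (fun z => a - m * bump c r z) (-(m • bumpGrad c r x)) x := by
  have h := (((hasGradientAt_bump hr hx).hasFDerivAt.const_mul m).const_sub a).hasGradientAt
  simpa using h

theorem bumpGrad_lipschitz {d : ℕ} {c : Space d} {r : ℝ} (hr : 0 < r) :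
    LipschitzOnWith (3 / r ^ 2).toNNReal (bumpGrad c r) (Metric.ball c (2 * r)) := by
  refine LipschitzOnWith.of_dist_le_mul fun x hx y hy => ?_
  rw [mem_ball_iff_norm] at hx hy
  rw [dist_eq_norm, dist_eq_norm, Real.coe_toNNReal _ (by positivity)]
  have h1 : bumpGrad c r x - bumpGrad c r y = (-(1 / r ^ 2)) • (bumpRoot c r x • (x - y) +
      (bumpRoot c r x - bumpRoot c r y) • (y - c)) := by
    unfold bumpGrad
    module
  have h2 : |bumpRoot c r x - bumpRoot c r y| ≤ ‖x - y‖ / r := by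
    rw [bumpRoot_eq hx.le, bumpRoot_eq hy.le]
    have h3 : |‖y - c‖ - ‖x - c‖| ≤ ‖x - y‖ := by
      have := abs_norm_sub_norm_le (y - c) (x - c)
      rwa [sub_sub_sub_cancel_right, norm_sub_rev y x] at this
    rw [show 1 - ‖x - c‖ ^ 2 / (4 * r ^ 2) - (1 - ‖y - c‖ ^ 2 / (4 * r ^ 2)) =
      (‖y - c‖ - ‖x - c‖) * ((‖y - c‖ + ‖x - c‖) / (4 * r ^ 2)) by ring, abs_mul,
      abs_of_nonneg (show 0 ≤ (‖y - c‖ + ‖x - c‖) / (4 * r ^ 2) by positivity)]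
    calc _ ≤ ‖x - y‖ * ((2 * r + 2 * r) / (4 * r ^ 2)) := by gcongr
      _ = _ := by field_simp; ring
  have hp := bumpRoot_nonneg c r x
  have hp1 := bumpRoot_le_one c r x
  rw [h1, norm_smul, norm_neg, Real.norm_of_nonneg (by positivity)]
  calc _ ≤ 1 / r ^ 2 * (1 * ‖x - y‖ + ‖x - y‖ / r * (2 * r)) := by
        gcongr
        refine (norm_add_le _ _).trans ?_
        rw [norm_smul, norm_smul, Real.norm_of_nonneg hp, Real.norm_eq_abs]
        gcongr
    _ = _ := by field_simp; norm_num

/-- Compensated differences of the bump: they are bounded below by the root of the bump, and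
there is a gain near the boundary of its support. -/
theorem compDiff_bump_ge {d : ℕ} {s : ℝ} {c : Space d} {r : ℝ} (hr : 0 < r) {x : Space d}
    (hx : ‖x - c‖ ≤ 2 * r) (y : Space d) :
    (if 3 / 2 * r ≤ ‖x - c‖ ∧ ‖x + y - c‖ < r / 2 then 1 / 2 else 0)
      - 3 * bumpRoot c r x * kernelWeight s r y
      ≤ compDiff s r (bump c r) (bumpGrad c r x) x y := by
  have hp := bumpRoot_nonneg c r x
  have hp1 := bumpRoot_le_one c r x
  have hpp : bump c r x ≤ bumpRoot c r x := by unfold bump; nlinarith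
  have hg := norm_bumpGrad_le hr hx
  have hin : |inner ℝ y (bumpGrad c r x)| ≤ 2 * bumpRoot c r x * (‖y‖ / r) := by
    calc _ ≤ ‖y‖ * ‖bumpGrad c r x‖ := abs_real_inner_le_norm _ _
      _ ≤ ‖y‖ * (2 * bumpRoot c r x / r) := by gcongr
      _ = _ := by ring
  have hsub := bump_sub_ge hr hx y
  set p := bumpRoot c r x
  set t := ‖y‖ / r with ht
  have ht0 : 0 ≤ t := by positivity
  by_cases hy : ‖y‖ < r
  · have ht1 : t ≤ 1 := (div_le_one hr).2 hy.le
    -- A jump from outside the ball of radius `3r/2` into that of radius `r/2` has length greater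
    -- than `r`, so the gain concerns long jumps only.
    have hng : ¬ (3 / 2 * r ≤ ‖x - c‖ ∧ ‖x + y - c‖ < r / 2) := by
      rintro ⟨h1, h2⟩
      have := norm_sub_le (x + y - c) y
      rw [show x + y - c - y = x - c by abel] at this
      linarith
    rw [if_neg hng, kernelWeight, if_pos hy, ← ht, nearExp]
    by_cases h1 : s < 1 / 2
    · rw [if_pos h1, compDiff, if_pos h1, pow_one]
      have := (abs_le.1 hin).1
      have : p * t ^ 2 ≤ p * t := mul_le_mul_of_nonneg_left (by nlinarith) hp
      have : 0 ≤ p * t := by positivity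
      linarith
    · rw [if_neg h1, compDiff, if_neg h1, if_pos hy, ite_self]
      have : 0 ≤ p * t ^ 2 := by positivity
      linarith
  · have ht1 : 1 ≤ t := (one_le_div hr).2 (not_lt.1 hy)
    have hgain : (if 3 / 2 * r ≤ ‖x - c‖ ∧ ‖x + y - c‖ < r / 2 then (1 / 2 : ℝ) else 0)
        ≤ bump c r (x + y) := by
      split_ifs with h
      · have h1 := le_bumpRoot (θ := 1 / 2) hr (by linarith [h.2] :
          ‖x + y - c‖ ≤ 1 / 2 * r)
        unfold bump
        nlinarith
      · exact bump_nonneg _ _ _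
    rw [kernelWeight, if_neg hy, ← ht, farExp]
    by_cases h1 : 1 / 2 < s
    · rw [if_pos h1, compDiff, if_neg h1.not_gt, if_neg h1.ne', pow_one]
      have := (abs_le.1 hin).2
      have : p ≤ p * t := le_mul_of_one_le_right hp ht1
      linarith
    · have hc : compDiff s r (bump c r) (bumpGrad c r x) x y = bump c r (x + y) - bump c r x := by
        rw [compDiff, if_neg hy, sub_zero]
        split_ifs with h3 h4
        · rfl
        · rfl
        · exact absurd (lt_of_le_of_ne (not_lt.1 h3) (Ne.symm h4)) h1
      rw [if_neg h1, hc, pow_zero]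
      linarith

/-! ### The nonlocal operator at a contact point -/

/-- Upper bound for `L_K v(x₀)` if `v` is touched from above at `x₀` by `a - m * bump`, in terms of
the measure of the gap between them. -/
theorem IsAdmissibleKernel.nonlocalOp_touching_le {d : ℕ} {s lam Lam ρ : ℝ} {K : Space d → ℝ}
    (hK : IsAdmissibleKernel d s lam Lam ρ K) (hs0 : 0 < s) (hs1 : s < 1) (hlam : 0 < lam)
    (hLam : 0 < Lam) (hρ : 0 ≤ ρ) {r : ℝ} {n : ℤ} (hrn : r = 2 ^ n) (hρr : ρ ≤ r) {C : ℝ}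
    (hC : Integrable (fun y => kernelWeight s r y * K y) ∧
      ∫ y, kernelWeight s r y * K y ≤ C * r ^ (-(2 * s)))
    {c x₀ : Space d} (hx₀ : ‖x₀ - c‖ < 2 * r) {m a S : ℝ} (hm : 0 ≤ m) (hSa : S ≤ a)
    {u : Space d → ℝ} (hu : AEStronglyMeasurable u) {M : ℝ} (hM : ∀ᵐ z, |u z| ≤ M)
    {ε : ℝ} (hε : 0 < ε) (hεr : ε ≤ r)
    (hua : ∀ z, ‖z - c‖ < 2 * r → u z ≤ a - m * bump c r z)
    {v : Space d → ℝ} (hv1 : ∀ z, ‖z - x₀‖ < ε → v z = a - m * bump c r z)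
    (hv2 : ∀ z, ¬ ‖z - x₀‖ < ε → v z = u z)
    {τ : ℝ} (hτ : 0 ≤ τ)
    (htail : ∫⁻ y, ENNReal.ofReal (u (x₀ + y) - S) * ENNReal.ofReal (K y) ≤ ENNReal.ofReal τ)
    {κ : ℝ} (hκ0 : 0 ≤ κ) (hκ : κ ≤ lam * (4 * r) ^ (-(d : ℝ) - 2 * s)) :
    nonlocalOp s K v x₀ ≤ 3 * m * bumpRoot c r x₀ * (C * r ^ (-(2 * s))) + τ
      - (if 3 / 2 * r ≤ ‖x₀ - c‖ then m / 2 * (lam * (4 * r) ^ (-(d : ℝ) - 2 * s)) else 0)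
          * volume.real (Metric.ball (0 : Space d) (r / 2))
      - κ * ∫ z in Metric.ball c r \ Metric.ball x₀ ε, (S - m - u z) := by
  classical
  have hr : 0 < r := by rw [hrn]; positivity
  set κ' := lam * (4 * r) ^ (-(d : ℝ) - 2 * s) with hκ'
  have hlow : ∀ y : Space d, y ≠ 0 → ‖y‖ ≤ 4 * r → κ' ≤ K y := fun y hy hy' =>
    hK.lower_of_norm_le hs0 hlam hρ (by linarith) hy hy'
  set φ : Space d → ℝ := fun z => a - m * bump c r z with hφ
  have hvφ : v x₀ = φ x₀ := hv1 x₀ (by simpa using hε)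
  have hgφ := hasGradientAt_const_sub_mul_bump a m hr hx₀
  have hgrad : gradient v x₀ = -(m • bumpGrad c r x₀) := by
    refine (HasGradientAt.congr_of_eventuallyEq hgφ ?_).gradient
    filter_upwards [Metric.ball_mem_nhds x₀ hε] with z hz
    exact hv1 z (mem_ball_iff_norm.1 hz)
  have hmp : MeasurePreserving (fun y : Space d => x₀ + y) volume volume :=
    measurePreserving_add_left volume x₀
  have hM0 : 0 ≤ M := by
    obtain ⟨z, hz⟩ := hM.exists
    exact (abs_nonneg _).trans hz
  have hφb : ∀ z, |φ z| ≤ |a| + m := fun z => by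
    refine (abs_sub _ _).trans (add_le_add_right ?_ _)
    rw [abs_of_nonneg (mul_nonneg hm (bump_nonneg c r z))]
    exact mul_le_of_le_one_right hm (bump_le_one c r z)
  have hvm : AEStronglyMeasurable v := by
    have : v = (Metric.ball x₀ ε).piecewise φ u := by
      ext z
      by_cases hz : ‖z - x₀‖ < ε
      · rw [piecewise_eq_of_mem _ _ _ (mem_ball_iff_norm.2 hz), hv1 z hz]
      · rw [piecewise_eq_of_notMem _ _ _ (fun h => hz (mem_ball_iff_norm.1 h)), hv2 z hz]
    rw [this]
    exact AEStronglyMeasurable.piecewise measurableSet_ball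
      ((continuous_const.sub ((continuous_bump c r).const_mul m)).aestronglyMeasurable.restrict)
      hu.restrict
  -- Needed both to change the compensation radius and to compare integrals: a Bochner integral of a
  -- nonintegrable function would be `0`.
  have hint : Integrable fun y => compDiff s r v (gradient v x₀) x₀ y * K y := by
    refine hK.integrable_compDiff hs0 hs1 hLam hvm (M := m * (2 / r ^ 2) + M + |a| + m)
      (by positivity) hε hεr (fun y hy => ?_) ?_
    · rw [hv1 _ (by simpa using hy), hvφ, hgrad, inner_neg_right, inner_smul_right]
      have h1 := abs_bump_sub_le hr hx₀.le (y := y) (hy.le.trans hεr)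
      rw [show a - m * bump c r (x₀ + y) - φ x₀ - -(m * inner ℝ y (bumpGrad c r x₀)) =
        -(m * (bump c r (x₀ + y) - bump c r x₀ - inner ℝ y (bumpGrad c r x₀))) by
          simp only [hφ]; ring, abs_neg, abs_mul, abs_of_nonneg hm]
      calc _ ≤ m * (2 / r ^ 2 * ‖y‖ ^ 2) := by gcongr
        _ = m * (2 / r ^ 2) * ‖y‖ ^ 2 := by ring
        _ ≤ _ := by
          refine mul_le_mul_of_nonneg_right ?_ (by positivity)
          linarith [abs_nonneg a]
    · filter_upwards [hM] with z hz
      have : 0 ≤ m * (2 / r ^ 2) := by positivity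
      by_cases h : ‖z - x₀‖ < ε
      · rw [hv1 z h]
        have := hφb z
        simp only [hφ] at this
        linarith
      · rw [hv2 z h]
        linarith [abs_nonneg a]
  set T : Space d → ℝ := fun y => max 0 (u (x₀ + y) - S) * K y with hT
  have hTnn : ∀ y, 0 ≤ T y := fun y => mul_nonneg (le_max_left _ _) (hK.nonneg y)
  have hTm : AEStronglyMeasurable T :=
    ((aestronglyMeasurable_const.sup ((hu.comp_measurePreserving hmp).sub
      aestronglyMeasurable_const))).mul hK.measurable.aestronglyMeasurable
  have hTl : ∫⁻ y, ENNReal.ofReal (T y) ≤ ENNReal.ofReal τ := by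
    refine le_trans (le_of_eq (lintegral_congr fun y => ?_)) htail
    rw [hT, ENNReal.ofReal_mul (le_max_left _ _), ENNReal.ofReal_max, ENNReal.ofReal_zero,
      max_eq_right zero_le]
  have hTi : Integrable T := ⟨hTm, by
    rw [hasFiniteIntegral_iff_ofReal (ae_of_all _ hTnn)]
    exact hTl.trans_lt ENNReal.ofReal_lt_top⟩
  have hTint : ∫ y, T y ≤ τ := by
    rw [integral_eq_lintegral_of_nonneg_ae (ae_of_all _ hTnn) hTm]
    exact ENNReal.toReal_le_of_le_ofReal hτ hTl
  set γ : ℝ := if 3 / 2 * r ≤ ‖x₀ - c‖ then m / 2 * κ' else 0 with hγ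
  set G : Space d → ℝ := (Metric.ball (c - x₀) (r / 2)).indicator fun _ => γ with hG
  have hGi : Integrable G := (integrable_indicator_iff measurableSet_ball).2
    (integrableOn_const (measure_ball_lt_top.ne))
  have hGint : ∫ y, G y = γ * volume.real (Metric.ball (0 : Space d) (r / 2)) := by
    rw [hG, integral_indicator measurableSet_ball, setIntegral_const, smul_eq_mul, mul_comm,
      Measure.real, Measure.addHaar_ball_center, ← Measure.real]
  set E : Set (Space d) := Metric.ball c r \ Metric.ball x₀ ε with hE
  have hEm : MeasurableSet E := measurableSet_ball.diff measurableSet_ball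
  set H : Space d → ℝ := E.indicator fun z => S - m - u z with hH
  have hHi : Integrable H := by
    refine (integrable_indicator_iff hEm).2 ?_
    refine Measure.integrableOn_of_bounded (M := |S - m| + M)
      ((measure_mono sdiff_subset).trans_lt measure_ball_lt_top).ne
      (aestronglyMeasurable_const.sub hu) ?_
    filter_upwards [ae_restrict_of_ae hM] with z hz
    exact (abs_sub _ _).trans (by linarith)
  have hHint : ∫ y, H (x₀ + y) = ∫ z in E, (S - m - u z) := by
    rw [integral_add_left_eq_self H x₀, hH, integral_indicator hEm]
  have hHx : Integrable fun y => H (x₀ + y) := hHi.comp_add_left x₀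
  rw [hK.nonlocalOp_eq n v x₀ (by rwa [← hrn]), ← hrn]
  set q := bumpRoot c r x₀
  have hq : 0 ≤ q := bumpRoot_nonneg c r x₀
  -- The difference of `v` splits into that of `φ` and the jump `v - φ`. The former gives the error
  -- in `q` and the gain `G`. The latter vanishes on the small ball around `x₀`, is at most `-κ`
  -- times the gap in the rest of the ball of radius `r`, is nonpositive up to radius `2r`, and is
  -- dominated beyond by the tail `T`, since there `φ = a ≥ S`. As `G` and `H` come from different
  -- summands, nothing is counted twice.
  have hpt : ∀ y, compDiff s r v (gradient v x₀) x₀ y * K y ≤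
      3 * m * q * (kernelWeight s r y * K y) + T y - G y - κ * H (x₀ + y) := by
    intro y
    have hKy := hK.nonneg y
    have hsum : ∀ z : Space d, x₀ + z - x₀ = z := fun z => add_sub_cancel_left x₀ z
    have h1 : (v (x₀ + y) - φ (x₀ + y)) * K y ≤ T y - κ * H (x₀ + y) := by
      by_cases hy : ‖y‖ < ε
      · have : x₀ + y ∉ E := fun h => h.2 (by simpa [mem_ball_iff_norm] using hy)
        rw [hH, indicator_of_notMem this, hv1 _ (by simpa using hy)]
        simpa [hφ] using hTnn y
      · rw [hv2 _ (by simpa using hy)]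
        by_cases h2 : ‖x₀ + y - c‖ < 2 * r
        · have h3 := hua _ h2
          have h4 : u (x₀ + y) - φ (x₀ + y) ≤ 0 := by simp only [hφ]; linarith
          by_cases h5 : ‖x₀ + y - c‖ < r
          · have hmem : x₀ + y ∈ E :=
              ⟨mem_ball_iff_norm.2 h5, fun h => hy (by simpa [mem_ball_iff_norm] using h)⟩
            rw [hH, indicator_of_mem hmem]
            have hy0 : y ≠ 0 := fun h => hy (by simpa [h] using hε)
            have hyr : ‖y‖ ≤ 4 * r := by
              have := norm_sub_le (x₀ + y - c) (x₀ - c)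
              rw [show x₀ + y - c - (x₀ - c) = y by abel] at this
              linarith
            have h6 := mul_le_mul_of_nonpos_left (hκ.trans (hlow y hy0 hyr)) h4
            have h7 : φ (x₀ + y) ≥ S - m := by
              have := mul_le_of_le_one_right hm (bump_le_one c r (x₀ + y))
              simp only [hφ]; linarith
            have h8 := mul_le_mul_of_nonneg_left h7.le hκ0
            have := hTnn y
            nlinarith
          · rw [hH, indicator_of_notMem fun h => h5 (mem_ball_iff_norm.1 h.1)]
            have := hTnn y
            nlinarith
        · have h5 : ¬ ‖x₀ + y - c‖ < r := fun h => h2 (by linarith)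
          rw [hH, indicator_of_notMem fun h => h5 (mem_ball_iff_norm.1 h.1), mul_zero, sub_zero]
          refine mul_le_mul_of_nonneg_right ?_ hKy
          simp only [hφ, bump_eq_zero hr (not_lt.1 h2), mul_zero, sub_zero]
          exact le_trans (by linarith) (le_max_right _ _)
    have h2 : compDiff s r φ (gradient v x₀) x₀ y * K y ≤
        3 * m * q * (kernelWeight s r y * K y) - G y := by
      rw [hgrad, hφ, compDiff_const_sub_mul]
      have h3 := mul_le_mul_of_nonneg_right (mul_le_mul_of_nonneg_left
        (compDiff_bump_ge (s := s) hr hx₀.le y) hm) hKy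
      have h4 : G y ≤ m * (if 3 / 2 * r ≤ ‖x₀ - c‖ ∧ ‖x₀ + y - c‖ < r / 2 then 1 / 2 else 0)
          * K y := by
        by_cases h5 : y ∈ Metric.ball (c - x₀) (r / 2)
        · have h6 : ‖x₀ + y - c‖ < r / 2 := by
            rw [mem_ball_iff_norm] at h5
            rwa [show x₀ + y - c = y - (c - x₀) by abel]
          rw [hG, indicator_of_mem h5, hγ]
          by_cases h7 : 3 / 2 * r ≤ ‖x₀ - c‖
          · rw [if_pos h7, if_pos ⟨h7, h6⟩, mul_one_div]
            have h8 := norm_sub_le (x₀ + y - c) y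
            rw [show x₀ + y - c - y = x₀ - c by abel] at h8
            have h9 := norm_sub_le (x₀ + y - c) (x₀ - c)
            rw [show x₀ + y - c - (x₀ - c) = y by abel] at h9
            refine mul_le_mul_of_nonneg_left (hlow y ?_ (by linarith)) (by positivity)
            exact norm_pos_iff.1 (by linarith)
          · rw [if_neg h7, if_neg fun h => h7 h.1]
            simp
        · rw [hG, indicator_of_notMem h5]
          have : (0 : ℝ) ≤ if 3 / 2 * r ≤ ‖x₀ - c‖ ∧ ‖x₀ + y - c‖ < r / 2 then 1 / 2 else 0 := by
            split_ifs <;> norm_num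
          positivity
      nlinarith
    rw [compDiff_sub (w := φ) hvφ, add_mul]
    linarith
  have hI1 : Integrable fun y => 3 * m * q * (kernelWeight s r y * K y) := hC.1.const_mul _
  have hI2 : Integrable fun y => 3 * m * q * (kernelWeight s r y * K y) + T y := hI1.add hTi
  have hI3 : Integrable fun y => 3 * m * q * (kernelWeight s r y * K y) + T y - G y := hI2.sub hGi
  have hI4 : Integrable fun y => κ * H (x₀ + y) := hHx.const_mul κ
  calc _ ≤ ∫ y, (3 * m * q * (kernelWeight s r y * K y) + T y - G y - κ * H (x₀ + y)) :=
        integral_mono hint (hI3.sub hI4) hpt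
    _ = 3 * m * q * (∫ y, kernelWeight s r y * K y) + (∫ y, T y)
        - γ * volume.real (Metric.ball (0 : Space d) (r / 2)) - κ * ∫ z in E, (S - m - u z) := by
        rw [integral_sub hI3 hI4, integral_sub hI2 hGi, integral_add hI1 hTi, integral_const_mul,
          integral_const_mul, hGint, hHint]
    _ ≤ _ := by
        have := mul_le_mul_of_nonneg_left hC.2 (show 0 ≤ 3 * m * q by positivity)
        linarith

/-! ### Null sets of exceptional times -/

/-- For a null set `N` of times there is a small continuous nondecreasing function with infinite
left derivative on `N`. -/
theorem exists_monotone_steep_on_null {N : Set ℝ} (hN : volume N = 0) {η : ℝ} (hη : 0 < η) :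
    ∃ ψ : ℝ → ℝ, Continuous ψ ∧ Monotone ψ ∧ (∀ t, 0 ≤ ψ t) ∧ (∀ t, ψ t ≤ η) ∧
      ∀ t₀ ∈ N, ∀ q : ℝ, ∃ δ > 0, ∀ t ∈ Ioc (t₀ - δ) t₀, ψ t ≤ ψ t₀ - q * (t₀ - t) := by
  set f : ℝ → ENNReal := (toMeasurable volume N).indicator fun _ => ⊤ with hf
  have hfm : Measurable f := measurable_const.indicator (measurableSet_toMeasurable _ _)
  have hf0 : ∫⁻ x, f x = 0 := by
    rw [hf, lintegral_indicator (measurableSet_toMeasurable _ _), setLIntegral_const,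
      measure_toMeasurable, hN, mul_zero]
  -- Vitali–Carathéodory: the function `∞` on a null set has integral zero, hence a lower
  -- semicontinuous majorant `g` of integral at most `η`. Lower semicontinuity makes `g > q` near
  -- each point of `N`, so the primitive of `g` has slope at least `q` there.
  obtain ⟨g, hfg, hg, hgi⟩ := exists_le_lowerSemicontinuous_lintegral_ge volume f hfm
    (ε := ENNReal.ofReal η) (by simpa using hη)
  rw [hf0, zero_add] at hgi
  have hgt : ∫⁻ x, g x ≠ ⊤ := (hgi.trans_lt ENNReal.ofReal_lt_top).ne
  have hgm : Measurable g := hg.measurable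
  have hG : Integrable fun x => (g x).toReal := integrable_toReal_of_lintegral_ne_top
    hgm.aemeasurable hgt
  have hGη : ∫ x, (g x).toReal ≤ η := by
    rw [integral_toReal hgm.aemeasurable (ae_lt_top hgm hgt)]
    exact ENNReal.toReal_le_of_le_ofReal hη.le hgi
  have hdiff : ∀ t t₀, (∫ x in Iic t₀, (g x).toReal) - ∫ x in Iic t, (g x).toReal
      = ∫ x in t..t₀, (g x).toReal := fun t t₀ =>
    intervalIntegral.integral_Iic_sub_Iic hG.integrableOn hG.integrableOn
  refine ⟨fun t => ∫ x in Iic t, (g x).toReal, ?_, ?_, ?_, ?_, ?_⟩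
  · have h : (fun t => ∫ x in Iic t, (g x).toReal) =
        fun t => (∫ x in Iic (0 : ℝ), (g x).toReal) + ∫ x in (0 : ℝ)..t, (g x).toReal := by
      ext t; rw [← hdiff 0 t]; ring
    rw [h]
    exact continuous_const.add (intervalIntegral.continuous_primitive
      (fun a b => hG.intervalIntegrable) 0)
  · intro t t' h
    exact setIntegral_mono_set hG.integrableOn (ae_of_all _ fun _ => ENNReal.toReal_nonneg)
      (Iic_subset_Iic.2 h).eventuallyLE
  · exact fun t => integral_nonneg fun _ => ENNReal.toReal_nonneg
  · exact fun t => (setIntegral_le_integral hG (ae_of_all _ fun _ => ENNReal.toReal_nonneg)).trans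
      hGη
  · intro t₀ ht₀ q
    have hgt₀ : ENNReal.ofReal q < g t₀ := by
      refine lt_of_lt_of_le ?_ (hfg t₀)
      rw [hf, indicator_of_mem (subset_toMeasurable _ _ ht₀)]
      exact ENNReal.ofReal_lt_top
    obtain ⟨δ, hδ, hball⟩ := Metric.eventually_nhds_iff.1 (hg t₀ _ hgt₀)
    refine ⟨δ, hδ, fun t ht => ?_⟩
    have h1 := hdiff t t₀
    have h2 : ∫ _ in t..t₀, q ≤ ∫ x in t..t₀, (g x).toReal := by
      refine intervalIntegral.integral_mono_ae_restrict ht.2 (by simp)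
        hG.intervalIntegrable ?_
      filter_upwards [ae_restrict_of_ae (ae_lt_top hgm hgt), ae_restrict_mem measurableSet_Icc]
        with x hx hxt
      have := hball (y := x) (by
        rw [Real.dist_eq, abs_lt]; constructor <;> linarith [hxt.1, hxt.2, ht.1])
      exact (ENNReal.ofReal_le_iff_le_toReal hx.ne).1 this.le
    rw [intervalIntegral.integral_const, smul_eq_mul] at h2
    linarith

/-- Fubini. Exceptional times are unavoidable: a slice is essentially bounded at every time, but its
bound may exceed the space-time essential supremum on a null set of times. -/
theorem IsLInfty.exists_null_slice_le {d : ℕ} {I : Set ℝ} (hI : MeasurableSet I)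
    {u : Space d → ℝ → ℝ} (hu : IsLInfty I u) :
    ∃ N : Set ℝ, volume N = 0 ∧ ∀ t ∈ I, t ∉ N → ∀ᵐ x, |u x t| ≤ normLInfty I u := by
  have h1 : ∀ᵐ p ∂(volume : Measure (Space d × ℝ)).restrict (univ ×ˢ I),
      |u p.1 p.2| ≤ normLInfty I u := by
    filter_upwards [ae_le_eLpNormEssSup (f := Function.uncurry u)
      (μ := (volume : Measure (Space d × ℝ)).restrict (univ ×ˢ I))] with p hp
    rw [← eLpNorm_exponent_top] at hp
    have := (ENNReal.toReal_le_toReal (by simp) hu.1.eLpNorm_ne_top).2 hp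
    simpa [normLInfty, Function.uncurry] using this
  rw [Measure.volume_eq_prod, ← Measure.prod_restrict, Measure.restrict_univ] at h1
  have h2 := Measure.ae_ae_of_ae_prod
    (Measure.measurePreserving_swap (μ := volume.restrict I) (ν := (volume : Measure (Space d)))
      |>.quasiMeasurePreserving.ae h1)
  refine ⟨{t | t ∈ I ∧ ¬ ∀ᵐ x, |u x t| ≤ normLInfty I u}, ?_, fun t ht htN => ?_⟩
  · have := (ae_restrict_iff' hI).1 h2
    rw [ae_iff] at this
    convert this using 2
    ext t
    simp [Prod.swap]
  · by_contra h
    exact htN ⟨ht, h⟩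

/-- By continuity a larger value at one point would persist on a relative neighbourhood, which has
positive measure in space at a positive measure of times. So inside the domain the essential bound
holds everywhere. -/
theorem IsLInfty.abs_le_of_continuousOn {d : ℕ} {Ω : Set (Space d)} (hΩ : IsOpen Ω) {a b : ℝ}
    {u : Space d → ℝ → ℝ} (hu : IsLInfty (Ioc a b) u)
    (hc : ContinuousOn (Function.uncurry u) (Ω ×ˢ Ioc a b)) {x : Space d} (hx : x ∈ Ω) {t : ℝ}
    (ht : t ∈ Ioc a b) : |u x t| ≤ normLInfty (Ioc a b) u := by
  by_contra! hlt
  obtain ⟨N, hN, hN'⟩ := hu.exists_null_slice_le measurableSet_Ioc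
  have hcw : ContinuousWithinAt (fun p : Space d × ℝ => |u p.1 p.2|) (Ω ×ˢ Ioc a b) (x, t) :=
    (hc (x, t) ⟨hx, ht⟩).abs
  have hev := hcw.eventually_const_lt hlt
  rw [nhdsWithin_prod_eq] at hev
  obtain ⟨P, hP, Q, hQ, hPQ⟩ := Filter.eventually_prod_iff.1 hev
  rw [hΩ.nhdsWithin_eq hx] at hP
  obtain ⟨t', htQ, htI, htN⟩ : ∃ t', Q t' ∧ t' ∈ Ioc a b ∧ t' ∉ N := by
    obtain ⟨δ, hδ, hδQ⟩ := Metric.mem_nhdsWithin_iff.1 hQ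
    -- Only times before `t` are used, since `t` may be the right endpoint `b`.
    have hmeas : volume (Ioc (max a (t - δ)) t \ N) ≠ 0 := by
      rw [measure_sdiff_null hN, Real.volume_Ioc]
      simpa using ⟨ht.1, hδ⟩
    obtain ⟨t', ht', hN⟩ := nonempty_of_measure_ne_zero hmeas
    have h1 := (le_max_left _ _).trans_lt ht'.1
    have h2 := (le_max_right _ _).trans_lt ht'.1
    have hI : t' ∈ Ioc a b := ⟨h1, ht'.2.trans ht.2⟩
    refine ⟨t', hδQ ⟨?_, hI⟩, hI, hN⟩
    rw [Metric.mem_ball, Real.dist_eq, abs_lt]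
    constructor <;> linarith [ht'.2]
  have h3 := hN' t' htI htN
  have hpos : volume {z | P z} ≠ 0 :=
    (Measure.measure_pos_of_mem_nhds volume hP).ne'
  obtain ⟨z, hz, hz'⟩ := nonempty_of_measure_ne_zero
    (μ := (volume : Measure (Space d))) (s := {z | P z} \ {z | ¬ |u z t'| ≤ normLInfty (Ioc a b) u})
    (by rw [measure_sdiff_null (ae_iff.1 h3)]; exact hpos)
  simp only [mem_ofPred_eq, not_not] at hz'
  exact absurd (hPQ hz htQ) (not_lt.2 hz')

/-! ### Symmetry under change of sign -/

theorem gradient_neg' {d : ℕ} (w : Space d → ℝ) (x : Space d) :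
    gradient (fun z => -w z) x = -gradient w x := by
  unfold gradient
  rw [show fderiv ℝ (fun z => -w z) x = -fderiv ℝ w x from fderiv_fun_neg, map_neg]

theorem nonlocalOp_neg {d : ℕ} (s : ℝ) (K w : Space d → ℝ) (x : Space d) :
    nonlocalOp s K (fun z => -w z) x = -nonlocalOp s K w x := by
  unfold nonlocalOp
  rw [← integral_neg]
  congr 1; ext y
  unfold diffOp
  rw [gradient_neg']
  split_ifs <;> simp only [inner_neg_right] <;> ring

/-- The real `sInf` is by definition minus the `sSup` of the reflected set, so default values agree
too and no boundedness has to be checked. -/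
theorem pucciInf_neg {d : ℕ} (s lam Lam ρ : ℝ) (w : Space d → ℝ) (x : Space d) :
    pucciInf s lam Lam ρ (fun z => -w z) x = -pucciSup s lam Lam ρ w x := by
  unfold pucciInf pucciSup
  simp_rw [nonlocalOp_neg]
  rw [Real.sInf_def]
  congr 2
  ext a
  simp [neg_eq_iff_eq_neg]

theorem IsTestFunction.neg {d : ℕ} {x₀ : Space d} {t₀ ε : ℝ} {φ : Space d → ℝ → ℝ}
    (h : IsTestFunction x₀ t₀ ε φ) : IsTestFunction x₀ t₀ ε fun x t => -φ x t where
  time x hx t ht := (h.time x hx t ht).neg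
  space t ht := (h.space t ht).neg
  spaceLip t ht := by
    obtain ⟨L, hL⟩ := h.spaceLip t ht
    refine ⟨L, ?_⟩
    have : (gradient fun x => -φ x t) = fun x => -gradient (fun x => φ x t) x :=
      funext (gradient_neg' _)
    rw [this]
    exact hL.neg

theorem glue_neg {d : ℕ} (x₀ : Space d) (t₀ ε : ℝ) (φ u : Space d → ℝ → ℝ) (x : Space d) (t : ℝ) :
    glue x₀ t₀ ε (fun x t => -φ x t) (fun x t => -u x t) x t = -glue x₀ t₀ ε φ u x t := by
  unfold glue; split_ifs <;> rfl

theorem IsLInfty.neg {d : ℕ} {I : Set ℝ} {u : Space d → ℝ → ℝ} (h : IsLInfty I u) :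
    IsLInfty I fun x t => -u x t :=
  ⟨h.1.neg, fun t ht => (h.2 t ht).neg⟩

/-- Reduces everything to subsolutions: the iteration uses only that `u` and `-u` are subsolutions
of the same equation. -/
theorem IsViscositySupersolution.neg {d : ℕ} {F F' : (Space d → ℝ) → Space d → ℝ}
    {f : Space d → ℝ → ℝ} {Ω : Set (Space d)} {I : Set ℝ} {u : Space d → ℝ → ℝ}
    (hF : ∀ w x, F (fun z => -w z) x = -F' w x)
    (h : IsViscositySupersolution F f Ω I u) :
    IsViscositySubsolution F' (fun x t => -f x t) Ω I fun x t => -u x t := by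
  refine ⟨h.1.neg, ?_, fun x₀ hx₀ t₀ ht₀ ε hε hsub φ hφ hu hle => ?_⟩
  · intro p hp y hy
    filter_upwards [h.2.1 p hp (-y) (by simp only [Function.uncurry] at hy ⊢; linarith)] with q hq
    simp only [Function.uncurry] at hq ⊢
    linarith
  · have h1 := h.2.2 x₀ hx₀ t₀ ht₀ ε hε hsub (fun x t => -φ x t) hφ.neg (by simp [← hu])
      (fun p hp => by have := hle p hp; linarith)
    have hg : glue x₀ t₀ ε (fun x t => -φ x t) u
        = fun x t => -glue x₀ t₀ ε φ (fun x t => -u x t) x t := by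
      ext x t
      rw [← glue_neg]; simp
    rw [hg, hF] at h1
    have hd : leftTimeDeriv (fun x t => -glue x₀ t₀ ε φ (fun x t => -u x t) x t) x₀ t₀
        = -leftTimeDeriv (glue x₀ t₀ ε φ fun x t => -u x t) x₀ t₀ := by
      unfold leftTimeDeriv
      exact derivWithin.fun_neg
    rw [hd] at h1
    linarith

/-! ### Ingredients of the barrier argument -/

/-- The damped linear equation `m' = g - β m` with zero initial value. -/
theorem exists_damped_ode {g : ℝ → ℝ} (hg : Continuous g) (hg0 : ∀ t, 0 ≤ g t) {β : ℝ}
    (hβ : 0 ≤ β) (a : ℝ) :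
    ∃ m : ℝ → ℝ, m a = 0 ∧ (∀ t, HasDerivAt m (g t - β * m t) t) ∧ (∀ t, a ≤ t → 0 ≤ m t) ∧
      ∀ t' t, a ≤ t' → t' ≤ t → Real.exp (-(β * (t - a))) * (∫ τ in a..t', g τ) ≤ m t := by
  have hc : Continuous fun τ => Real.exp (β * (τ - a)) * g τ := by fun_prop
  have hnn : ∀ τ, 0 ≤ Real.exp (β * (τ - a)) * g τ := fun τ =>
    mul_nonneg (Real.exp_pos _).le (hg0 τ)
  refine ⟨fun t => Real.exp (-(β * (t - a))) * ∫ τ in a..t, Real.exp (β * (τ - a)) * g τ,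
    by simp, fun t => ?_, fun t ht => ?_, fun t' t h1 h2 => ?_⟩
  · have h1 : HasDerivAt (fun t => Real.exp (-(β * (t - a)))) (Real.exp (-(β * (t - a))) * (-β)) t
        := by
      have : HasDerivAt (fun t => -(β * (t - a))) (-β) t := by
        simpa using (((hasDerivAt_id t).sub_const a).const_mul β).fun_neg
      exact this.exp
    have h2 := intervalIntegral.integral_hasDerivAt_right (hc.intervalIntegrable a t)
      (hc.stronglyMeasurableAtFilter _ _) hc.continuousAt
    refine (h1.mul h2).congr_deriv ?_
    rw [← mul_assoc (Real.exp _) (Real.exp _), ← Real.exp_add, neg_add_cancel, Real.exp_zero]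
    ring
  · exact mul_nonneg (Real.exp_pos _).le
      (intervalIntegral.integral_nonneg ht fun τ _ => hnn τ)
  · refine mul_le_mul_of_nonneg_left ?_ (Real.exp_pos _).le
    calc _ ≤ ∫ τ in a..t', Real.exp (β * (τ - a)) * g τ := by
          refine intervalIntegral.integral_mono_on h1 (hg.intervalIntegrable _ _)
            (hc.intervalIntegrable _ _) fun τ hτ => ?_
          exact le_mul_of_one_le_left (hg0 τ)
            (Real.one_le_exp (mul_nonneg hβ (by linarith [hτ.1])))
      _ ≤ _ := intervalIntegral.integral_mono_interval le_rfl h1 h2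
          (ae_of_all _ hnn) (hc.intervalIntegrable _ _)

/-- A bounded function that is nonpositive near `x` has a controlled positive tail at `x`. -/
theorem IsAdmissibleKernel.lintegral_tail_le {d : ℕ} {s lam Lam ρ : ℝ} {K : Space d → ℝ}
    (hK : IsAdmissibleKernel d s lam Lam ρ K) {r C : ℝ} (hr : 0 < r)
    (hC : Integrable (fun y => kernelWeight s r y * K y) ∧
      ∫ y, kernelWeight s r y * K y ≤ C * r ^ (-(2 * s)))
    {w : Space d → ℝ} {x : Space d} {B : ℝ} (hB : 0 ≤ B) (hw : ∀ᵐ z, w z ≤ B)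
    (hw0 : ∀ z, ‖z - x‖ < r → w z ≤ 0) :
    ∫⁻ y, ENNReal.ofReal (w (x + y)) * ENNReal.ofReal (K y)
      ≤ ENNReal.ofReal (B * (C * r ^ (-(2 * s)))) := by
  have hwx : ∀ᵐ y, w (x + y) ≤ B :=
    (measurePreserving_add_left volume x).quasiMeasurePreserving.ae hw
  calc _ ≤ ∫⁻ y, ENNReal.ofReal (B * (kernelWeight s r y * K y)) := by
        refine lintegral_mono_ae ?_
        filter_upwards [hwx] with y hy
        by_cases h : ‖y‖ < r
        · rw [ENNReal.ofReal_of_nonpos (hw0 (x + y) (by simpa using h)), zero_mul]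
          exact zero_le
        · rw [← mul_assoc, ENNReal.ofReal_mul (mul_nonneg hB (kernelWeight_nonneg hr y))]
          gcongr
          exact hy.trans (le_mul_of_one_le_right hB (one_le_kernelWeight hr (not_lt.1 h)))
    _ = ENNReal.ofReal (∫ y, B * (kernelWeight s r y * K y)) :=
        (ofReal_integral_eq_lintegral_ofReal (hC.1.const_mul B) (ae_of_all _ fun y =>
          mul_nonneg hB (mul_nonneg (kernelWeight_nonneg hr y) (hK.nonneg y)))).symm
    _ ≤ _ := by
        rw [integral_const_mul]
        exact ENNReal.ofReal_le_ofReal (mul_le_mul_of_nonneg_left hC.2 hB)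

/-- The viscosity inequality at a contact point with `a - m * bump`. -/
theorem IsViscositySubsolution.contact_le {d : ℕ} {s lam Lam ρ D A : ℝ} {Ω : Set (Space d)}
    {I : Set ℝ} {u : Space d → ℝ → ℝ}
    (hsub : IsViscositySubsolution
      (fun w x => pucciSup s lam Lam ρ w x + D * ‖gradient w x‖) (fun _ _ => A) Ω I u)
    (hne : (kernelClass d s lam Lam ρ).Nonempty) {c x₀ : Space d} {r t₀ ε : ℝ} (hr : 0 < r)
    (hx₀ : x₀ ∈ Ω) (ht₀ : t₀ ∈ I) (hε : 0 < ε) (hcyl : leftCyl x₀ t₀ ε ⊆ Ω ×ˢ I)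
    (hball : ∀ z, ‖z - x₀‖ < ε → ‖z - c‖ < 2 * r) {m m' : ℝ → ℝ}
    (hm : ∀ t, HasDerivAt m (m' t) t) (hm0 : 0 ≤ m t₀) {a q : ℝ}
    (hu0 : u x₀ t₀ = a - m t₀ * bump c r x₀)
    (hle : ∀ z, ‖z - x₀‖ < ε → ∀ t ∈ Ioc (t₀ - ε) t₀,
      u z t ≤ a - q * (t₀ - t) - m t * bump c r z)
    {X : ℝ} (hX : ∀ K, IsAdmissibleKernel d s lam Lam ρ K → ∀ v : Space d → ℝ,
      (∀ z, ‖z - x₀‖ < ε → v z = a - m t₀ * bump c r z) →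
      (∀ z, ¬ ‖z - x₀‖ < ε → v z = u z t₀) → nonlocalOp s K v x₀ ≤ X) :
    q - m' t₀ * bump c r x₀ ≤ A + X + D * (m t₀ * ‖bumpGrad c r x₀‖) := by
  set φ : Space d → ℝ → ℝ := fun z t => (a - q * (t₀ - t)) - m t * bump c r z with hφ
  have hφd : ∀ z t, HasDerivAt (φ z) (q - m' t * bump c r z) t := fun z t => by
    have h1 : HasDerivAt (fun t => a - q * (t₀ - t)) q t := by
      simpa using (((hasDerivAt_id t).const_sub t₀).const_mul q).const_sub a
    exact h1.sub ((hm t).mul_const _)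
  have hφg : ∀ t, ∀ z ∈ Metric.ball x₀ ε,
      HasGradientAt (fun z => φ z t) (-(m t • bumpGrad c r z)) z := fun t z hz =>
    hasGradientAt_const_sub_mul_bump _ _ hr (hball z (mem_ball_iff_norm.1 hz))
  have htest : IsTestFunction x₀ t₀ ε φ := by
    refine ⟨fun z _ t _ => (hφd z t).differentiableAt.differentiableWithinAt,
      fun t _ z hz => (hφg t z hz).differentiableAt.differentiableWithinAt,
      fun t _ => ?_⟩
    have h2 : LipschitzOnWith (3 / r ^ 2).toNNReal (bumpGrad c r) (Metric.ball x₀ ε) :=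
      (bumpGrad_lipschitz hr).mono fun z hz =>
        mem_ball_iff_norm.2 (hball z (mem_ball_iff_norm.1 hz))
    refine ⟨‖m t‖₊ * (3 / r ^ 2).toNNReal, LipschitzOnWith.of_dist_le_mul fun y hy z hz => ?_⟩
    rw [(hφg t y hy).gradient, (hφg t z hz).gradient, dist_neg_neg, dist_smul₀, NNReal.coe_mul,
      mul_assoc]
    exact mul_le_mul_of_nonneg_left (h2.dist_le_mul y hy z hz) (norm_nonneg _)
  have hle' : ∀ p ∈ leftCyl x₀ t₀ ε, u p.1 p.2 ≤ φ p.1 p.2 := fun p hp =>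
    hle p.1 (mem_ball_iff_norm.1 hp.1) p.2 hp.2
  have hmain := hsub.2.2 x₀ hx₀ t₀ ht₀ ε hε hcyl φ htest (by rw [hu0, hφ]; simp) hle'
  have hmem : ∀ z, ‖z - x₀‖ < ε → (z, t₀) ∈ leftCyl x₀ t₀ ε := fun z hz =>
    ⟨mem_ball_iff_norm.2 hz, by constructor <;> simp [hε]⟩
  have hv1 : ∀ z, ‖z - x₀‖ < ε → glue x₀ t₀ ε φ u z t₀ = a - m t₀ * bump c r z := fun z hz => by
    rw [glue, if_pos (hmem z hz)]; simp [hφ]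
  have hv2 : ∀ z, ¬ ‖z - x₀‖ < ε → glue x₀ t₀ ε φ u z t₀ = u z t₀ := fun z hz => by
    rw [glue, if_neg fun h => hz (mem_ball_iff_norm.1 h.1)]
  have htime : leftTimeDeriv (glue x₀ t₀ ε φ u) x₀ t₀ = q - m' t₀ * bump c r x₀ := by
    unfold leftTimeDeriv
    have heq : glue x₀ t₀ ε φ u x₀ =ᶠ[nhdsWithin t₀ (Iic t₀)] φ x₀ := by
      filter_upwards [Ioc_mem_nhdsLE (show t₀ - ε < t₀ by linarith)] with t ht
      rw [glue, if_pos ⟨Metric.mem_ball_self hε, ht⟩]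
    rw [heq.derivWithin_eq_of_mem self_mem_Iic]
    exact (hφd x₀ t₀).hasDerivWithinAt.derivWithin (uniqueDiffWithinAt_Iic t₀)
  have hgrad : gradient (fun z => glue x₀ t₀ ε φ u z t₀) x₀ = -(m t₀ • bumpGrad c r x₀) := by
    refine (HasGradientAt.congr_of_eventuallyEq (hφg t₀ x₀ (Metric.mem_ball_self hε)) ?_).gradient
    filter_upwards [Metric.ball_mem_nhds x₀ hε] with z hz
    rw [glue, if_pos (hmem z (mem_ball_iff_norm.1 hz))]
  have hsup : pucciSup s lam Lam ρ (fun z => glue x₀ t₀ ε φ u z t₀) x₀ ≤ X := by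
    -- Nonemptiness of the class matters: the supremum over the empty set would be `0`, which need
    -- not be below `X`.
    refine csSup_le (hne.image _) ?_
    rintro _ ⟨K, hK, rfl⟩
    exact hX K hK _ hv1 hv2
  rw [htime] at hmain
  beta_reduce at hmain
  rw [hgrad, norm_neg, norm_smul, Real.norm_of_nonneg hm0] at hmain
  linarith

/-- Dominated convergence. It makes the source of the equation for `m` continuous, so that `m` is
classically differentiable and can enter a test function. -/
theorem continuousOn_setIntegral_slice {d : ℕ} {c : Space d} {r a b S B : ℝ}
    {u : Space d → ℝ → ℝ}
    (hc : ContinuousOn (Function.uncurry u) (Metric.ball c r ×ˢ Icc a b))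
    (hB : ∀ x ∈ Metric.ball c r, ∀ t ∈ Icc a b, |S - u x t| ≤ B) :
    ContinuousOn (fun t => ∫ x in Metric.ball c r, (S - u x t)) (Icc a b) := by
  refine continuousOn_of_dominated (bound := fun _ => B) (fun t ht => ?_) (fun t ht => ?_)
    (integrableOn_const measure_ball_lt_top.ne) ?_
  · refine ContinuousOn.aestronglyMeasurable ?_ measurableSet_ball
    exact continuousOn_const.sub (hc.comp (f := fun x : Space d => (x, t)) (by fun_prop)
      fun x hx => ⟨hx, ht⟩)
  · exact (ae_restrict_iff' measurableSet_ball).2 (ae_of_all _ fun x hx => hB x hx t ht)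
  · refine (ae_restrict_iff' measurableSet_ball).2 (ae_of_all _ fun x hx => ?_)
    exact continuousOn_const.sub (hc.comp (f := fun t : ℝ => (x, t)) (by fun_prop)
      fun t ht => ⟨hx, ht⟩)

theorem volume_real_ball {d : ℕ} (c : Space d) {r : ℝ} (hr : 0 < r) :
    volume.real (Metric.ball c r) = r ^ d * volume.real (Metric.ball (0 : Space d) 1) := by
  rw [Measure.real, Measure.addHaar_ball_of_pos _ _ hr, ENNReal.toReal_mul,
    ENNReal.toReal_ofReal (by positivity), finrank_euclideanSpace_fin, Measure.real]

/-- The gap between `u` and its upper bound survives the removal of a small ball. -/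
theorem setIntegral_gap_ge {d : ℕ} {c x₀ : Space d} {r ε S m h : ℝ} (hm : 0 ≤ m) (hh : 0 ≤ h)
    {w : Space d → ℝ} (hwm : AEStronglyMeasurable w)
    (hw : ∀ x ∈ Metric.ball c r, S - 2 * h ≤ w x ∧ w x ≤ S) :
    (∫ x in Metric.ball c r, (S - w x)) - 2 * h * volume.real (Metric.ball x₀ ε)
      - m * volume.real (Metric.ball c r)
      ≤ ∫ x in Metric.ball c r \ Metric.ball x₀ ε, (S - m - w x) := by
  have hint : IntegrableOn (fun x => S - w x) (Metric.ball c r) := by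
    refine Measure.integrableOn_of_bounded (M := 2 * h) measure_ball_lt_top.ne
      (aestronglyMeasurable_const.sub hwm) ?_
    refine (ae_restrict_iff' measurableSet_ball).2 (ae_of_all _ fun x hx => ?_)
    have := hw x hx
    rw [Real.norm_eq_abs, abs_le]
    constructor <;> linarith
  have hfin : volume (Metric.ball c r \ Metric.ball x₀ ε) ≠ ⊤ :=
    ((measure_mono sdiff_subset).trans_lt measure_ball_lt_top).ne
  have h1 : ∫ x in Metric.ball c r \ Metric.ball x₀ ε, (S - m - w x) =
      (∫ x in Metric.ball c r \ Metric.ball x₀ ε, (S - w x))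
        - m * volume.real (Metric.ball c r \ Metric.ball x₀ ε) := by
    have : ∀ x, S - m - w x = (S - w x) - m := fun x => by ring
    simp_rw [this]
    rw [integral_sub (hint.mono_set sdiff_subset) (integrableOn_const hfin),
      setIntegral_const, smul_eq_mul, mul_comm m]
  have h2 := integral_inter_add_sdiff (measurableSet_ball (x := x₀) (ε := ε)) hint
  have h3 : ∫ x in Metric.ball c r ∩ Metric.ball x₀ ε, (S - w x)
      ≤ 2 * h * volume.real (Metric.ball x₀ ε) := by
    calc _ ≤ ∫ x in Metric.ball c r ∩ Metric.ball x₀ ε, 2 * h := by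
          refine setIntegral_mono_on (hint.mono_set inter_subset_left)
            (integrableOn_const ((measure_mono inter_subset_left).trans_lt
              measure_ball_lt_top).ne) (measurableSet_ball.inter measurableSet_ball)
            fun x hx => ?_
          linarith [(hw x hx.1).1]
      _ = 2 * h * volume.real (Metric.ball c r ∩ Metric.ball x₀ ε) := by
          rw [setIntegral_const, smul_eq_mul, mul_comm]
      _ ≤ _ := mul_le_mul_of_nonneg_left
          (measureReal_mono inter_subset_right measure_ball_lt_top.ne) (by positivity)
  have h4 : m * volume.real (Metric.ball c r \ Metric.ball x₀ ε)
      ≤ m * volume.real (Metric.ball c r) :=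
    mul_le_mul_of_nonneg_left (measureReal_mono sdiff_subset measure_ball_lt_top.ne) hm
  linarith

/-- The constant in the gain of the extremal operators near the boundary of the bump. -/
noncomputable def gainConst (d : ℕ) (s lam : ℝ) : ℝ :=
  lam * 4 ^ (-(d : ℝ) - 2 * s) * volume.real (Metric.ball (0 : Space d) 1) * (1 / 2) ^ d / 2

theorem volume_real_unit_ball_pos (d : ℕ) : 0 < volume.real (Metric.ball (0 : Space d) 1) :=
  ENNReal.toReal_pos (Metric.measure_ball_pos _ _ one_pos).ne' measure_ball_lt_top.ne

theorem gainConst_pos (d : ℕ) (s : ℝ) {lam : ℝ} (hlam : 0 < lam) : 0 < gainConst d s lam := by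
  have := volume_real_unit_ball_pos d
  unfold gainConst; positivity

theorem lower_bound_scaling {d : ℕ} {s lam r : ℝ} (hr : 0 < r) :
    lam * (4 * r) ^ (-(d : ℝ) - 2 * s)
      = lam * 4 ^ (-(d : ℝ) - 2 * s) / (r ^ d * r ^ (2 * s)) := by
  rw [Real.mul_rpow (by norm_num) hr.le, show -(d : ℝ) - 2 * s = -((d : ℝ) + 2 * s) by ring,
    Real.rpow_neg hr.le, Real.rpow_add hr, Real.rpow_natCast]
  ring

theorem gain_scaling {d : ℕ} {s lam r : ℝ} (hr : 0 < r) :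
    lam * (4 * r) ^ (-(d : ℝ) - 2 * s) * volume.real (Metric.ball (0 : Space d) (r / 2)) / 2
      = gainConst d s lam / r ^ (2 * s) := by
  rw [lower_bound_scaling hr, volume_real_ball _ (by positivity), gainConst, div_pow, div_pow, one_pow]
  field_simp

theorem le_lower_bound {d : ℕ} {s lam r a : ℝ} (hlam : 0 < lam) (hr : 0 < r)
    (ha : a ≤ gainConst d s lam) (c : Space d) :
    a / (volume.real (Metric.ball c r) * r ^ (2 * s)) ≤ lam * (4 * r) ^ (-(d : ℝ) - 2 * s) := by
  have hω := volume_real_unit_ball_pos d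
  rw [lower_bound_scaling hr, volume_real_ball _ hr, div_le_div_iff₀ (by positivity)
    (by positivity)]
  have h1 : a ≤ lam * 4 ^ (-(d : ℝ) - 2 * s) * volume.real (Metric.ball (0 : Space d) 1) := by
    refine ha.trans ?_
    unfold gainConst
    have h2 : ((1 : ℝ) / 2) ^ d ≤ 1 := pow_le_one₀ (by norm_num) (by norm_num)
    set X := lam * 4 ^ (-(d : ℝ) - 2 * s) * volume.real (Metric.ball (0 : Space d) 1)
    have hX : 0 < X := by positivity
    nlinarith
  calc _ ≤ lam * 4 ^ (-(d : ℝ) - 2 * s) * volume.real (Metric.ball (0 : Space d) 1)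
        * (r ^ d * r ^ (2 * s)) := by gcongr
    _ = _ := by ring

/-- The damping constant absorbs the error terms, thanks to the gain where the bump is small. -/
theorem damping_absorbs {C a g p β : ℝ} (hC : 0 ≤ C) (hg : 0 < g) (ha : 0 < a) (hag : a ≤ g / 2)
    (hp0 : 0 ≤ p) (hp1 : p ≤ 1) (hβ : β = C ^ 2 / (2 * g) + 6 * (C + a)) {P : Prop} [Decidable P]
    (hP : ¬ P → 7 / 16 ≤ p) :
    C * p + a - (if P then g else 0) ≤ β * p ^ 2 := by
  have h0 : 0 ≤ C ^ 2 / (2 * g) := by positivity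
  split_ifs with h
  · have h1 : C * p ≤ g / 2 + C ^ 2 / (2 * g) * p ^ 2 := by
      rw [← sub_nonneg]
      have : g / 2 + C ^ 2 / (2 * g) * p ^ 2 - C * p = (g - C * p) ^ 2 / (2 * g) := by
        field_simp; ring
      rw [this]; positivity
    have h2 : 0 ≤ 6 * (C + a) * p ^ 2 := by positivity
    rw [hβ]; nlinarith
  · have h1 := hP h
    -- Away from the edge `p ≥ 1 - (3/2)^2 / 4 = 7/16`, hence `6 p^2 ≥ 1` and the damping alone
    -- suffices.
    have h2 : 1 / 6 ≤ p ^ 2 := by nlinarith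
    have h3 : (C + a) * 1 ≤ (C + a) * (6 * p ^ 2) := by gcongr; linarith
    have h4 : C * p ≤ C := mul_le_of_le_one_right hC hp1
    have h5 : 0 ≤ C ^ 2 / (2 * g) * p ^ 2 := by positivity
    rw [hβ]; nlinarith

/-! ### The growth lemma -/

/-- Growth lemma: a subsolution below `S` that lies below `S - h` on average in the first half of
a cylinder lies below `S - θ h` in the second half. -/
def GrowthProperty (d : ℕ) (s lam Lam D₀ θ ε₀ : ℝ) : Prop :=
  ∀ (ρ D A : ℝ) (Ω : Set (Space d)) (I : Set ℝ)
      (u : Space d → ℝ → ℝ) (r : ℝ) (n : ℤ) (c : Space d) (t₁ S h : ℝ) (N : Set ℝ),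
      0 ≤ ρ → ρ ≤ r → r = 2 ^ n → (kernelClass d s lam Lam ρ).Nonempty →
      D * r ^ (2 * s) ≤ D₀ * r →
      IsViscositySubsolution (fun w x => pucciSup s lam Lam ρ w x + D * ‖gradient w x‖)
        (fun _ _ => A) Ω I u →
      ContinuousOn (Function.uncurry u) (Ω ×ˢ I) →
      Metric.ball c (4 * r) ⊆ Ω → Icc (t₁ - r ^ (2 * s)) t₁ ⊆ I →
      0 < h → A * r ^ (2 * s) ≤ ε₀ * h →
      (∀ x ∈ Metric.ball c (4 * r), ∀ t ∈ Icc (t₁ - r ^ (2 * s)) t₁,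
        S - 2 * h ≤ u x t ∧ u x t ≤ S) →
      volume N = 0 →
      (∀ t ∈ Icc (t₁ - r ^ (2 * s)) t₁, t ∉ N → ∀ K, IsAdmissibleKernel d s lam Lam ρ K →
        ∀ x, ‖x - c‖ < 2 * r → ∫⁻ y, ENNReal.ofReal (u (x + y) t - S) * ENNReal.ofReal (K y)
          ≤ ENNReal.ofReal (ε₀ * h * r ^ (-(2 * s)))) →
      h * volume.real (Metric.ball c r) * r ^ (2 * s) / 2 ≤
        ∫ t in (t₁ - r ^ (2 * s))..(t₁ - r ^ (2 * s) / 2), ∫ x in Metric.ball c r, (S - u x t) →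
      ∀ x ∈ Metric.ball c r, ∀ t ∈ Icc (t₁ - r ^ (2 * s) / 2) t₁, u x t ≤ S - θ * h

-- Comparison with the barrier `S - m b + κ₀ (t - ts) + ψ`. The mean hypothesis forces `m ≥ e h / 2`
-- in the second half, with `e = exp(-β₀) a₀`, while the terms added to keep the inequality at
-- contact strict cost only a small multiple of `e h`.
set_option maxHeartbeats 1000000 in
theorem exists_growthProperty (d : ℕ) (hd : 1 ≤ d) {s lam Lam : ℝ} (hs0 : 0 < s) (hs1 : s < 1)
    (hlam : 0 < lam) (hLam : 0 < Lam) {D₀ : ℝ} (hD₀ : 0 ≤ D₀) :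
    ∃ θ ε₀ : ℝ, 0 < θ ∧ θ < 1 ∧ 0 < ε₀ ∧ GrowthProperty d s lam Lam D₀ θ ε₀ := by
  obtain ⟨C, hC0, hC⟩ := exists_kernelWeight_bound d hs0 hs1 hLam
  set g₀ := gainConst d s lam with hg₀
  have hg₀p : 0 < g₀ := gainConst_pos d s hlam
  set a₀ := min (g₀ / 2) 1 with ha₀
  have ha₀p : 0 < a₀ := lt_min (by positivity) one_pos
  have ha₀g : a₀ ≤ g₀ / 2 := min_le_left _ _
  set C' := 3 * C + 2 * D₀ with hC'
  set β₀ := C' ^ 2 / (2 * g₀) + 6 * (C' + a₀) with hβ₀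
  have hβ₀p : 0 ≤ β₀ := by positivity
  set e := Real.exp (-β₀) * a₀ with he
  have hep : 0 < e := by positivity
  have he1 : e ≤ 1 := by
    have h1 : Real.exp (-β₀) ≤ 1 := Real.exp_le_one_iff.2 (by linarith)
    have h2 : a₀ ≤ 1 := min_le_right _ _
    calc e ≤ 1 * 1 := by rw [he]; gcongr
      _ = 1 := one_mul 1
  -- Since `b ≥ 9/16` on the ball of radius `r`, the final drop is at least `(e h / 2)(9/16)` less
  -- `3 ε₀ h` for the linear term and `ε₀ h` for `ψ`. With `ε₀ = e/32` this is `5 e h / 32`, more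
  -- than `e h / 8`.
  refine ⟨e / 8, e / 32, by positivity, by linarith, by positivity, ?_⟩
  intro ρ D A Ω I u r n c t₁ S h N hρ hρr hrn hne hD hsub hcont hΩ hI hh hA hosc hN htail hmean
  have hr : 0 < r := by rw [hrn]; positivity
  set T := r ^ (2 * s) with hT
  have hTp : 0 < T := by positivity
  have hTinv : r ^ (-(2 * s)) = T⁻¹ := Real.rpow_neg hr.le _
  set V := volume.real (Metric.ball c r) with hV
  have hVp : 0 < V := by
    rw [hV, volume_real_ball _ hr]
    have := volume_real_unit_ball_pos d
    positivity
  set ts := t₁ - T with hts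
  set g : ℝ → ℝ := fun t => ∫ x in Metric.ball c r, (S - u x t) with hg
  have hsub14 : Metric.ball c r ⊆ Metric.ball c (4 * r) := Metric.ball_subset_ball (by linarith)
  have hosc' : ∀ x ∈ Metric.ball c r, ∀ t ∈ Icc ts t₁, S - 2 * h ≤ u x t ∧ u x t ≤ S :=
    fun x hx t ht => hosc x (hsub14 hx) t ht
  have hgc : ContinuousOn g (Icc ts t₁) := by
    refine continuousOn_setIntegral_slice (B := 2 * h)
      (hcont.mono (prod_mono (hsub14.trans hΩ) hI)) fun x hx t ht => ?_
    have := hosc' x hx t ht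
    rw [abs_le]
    constructor <;> linarith
  have hg0 : ∀ t ∈ Icc ts t₁, 0 ≤ g t := fun t ht =>
    setIntegral_nonneg measurableSet_ball fun x hx => by linarith [(hosc' x hx t ht).2]
  set κ := a₀ / (V * T) with hκ
  have hκp : 0 < κ := by positivity
  have hκV : κ * V = a₀ / T := by rw [hκ]; field_simp
  -- Extends `g` continuously and nonnegatively to all times, as the differential equation is posed
  -- on the whole line.
  set clamp : ℝ → ℝ := fun t => max ts (min t t₁) with hclamp
  have hclm : ∀ t, clamp t ∈ Icc ts t₁ := fun t =>
    ⟨le_max_left _ _, max_le (by linarith) (min_le_right _ _)⟩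
  have hcle : ∀ t ∈ Icc ts t₁, clamp t = t := fun t ht => by
    simp only [hclamp]; rw [min_eq_left ht.2, max_eq_right ht.1]
  obtain ⟨m, hm0, hmd, hmnn, hmlow⟩ := exists_damped_ode (g := fun t => κ * g (clamp t))
    ((hgc.comp_continuous (by fun_prop) hclm).const_mul κ)
    (fun t => mul_nonneg hκp.le (hg0 _ (hclm t))) (show 0 ≤ β₀ / T by positivity) ts
  obtain ⟨ψ, hψc, hψm, hψ0, hψe, hψs⟩ := exists_monotone_steep_on_null hN
    (show 0 < e / 32 * h by positivity)
  -- The slope contributes `3 ε₀ h` after multiplication by `T`. It has to beat the right-hand side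
  -- (`ε₀ h`), the tail (`ε₀ h`) and the removed small ball (`ε₀ h / 2`).
  set κ₀ := 3 * (e / 32) * h / T with hκ₀
  have hκ₀p : 0 < κ₀ := by positivity
  set Φ : Space d × ℝ → ℝ := fun p =>
    u p.1 p.2 - (S - m p.2 * bump c r p.1 + κ₀ * (p.2 - ts) + ψ p.2) with hΦ
  have hmc : Continuous m := continuous_iff_continuousAt.2 fun t => (hmd t).continuousAt
  have hsub24 : Metric.closedBall c (2 * r) ⊆ Metric.ball c (4 * r) :=
    Metric.closedBall_subset_ball (by linarith)
  have hΦc : ContinuousOn Φ (Metric.closedBall c (2 * r) ×ˢ Icc ts t₁) := by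
    refine (hcont.mono (prod_mono (hsub24.trans hΩ) hI)).sub (Continuous.continuousOn ?_)
    have := continuous_bump c r
    fun_prop
  have hmain : ∀ p ∈ Metric.closedBall c (2 * r) ×ˢ Icc ts t₁, Φ p ≤ 0 := by
    have htsle : ts ≤ t₁ := by linarith
    obtain ⟨⟨x₀, t₀⟩, ⟨hx₀, ht₀⟩, hmax⟩ :=
      ((isCompact_closedBall c (2 * r)).prod isCompact_Icc).exists_isMaxOn
        ⟨(c, t₁), Metric.mem_closedBall_self (by positivity), htsle, le_rfl⟩ hΦc
    refine fun p hp => (hmax hp).trans ?_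
    by_contra! hpos
    have hmt := hmnn t₀ ht₀.1
    have hux := (hosc x₀ (hsub24 hx₀) t₀ ht₀).2
    have hts0 : 0 ≤ κ₀ * (t₀ - ts) := mul_nonneg hκ₀p.le (by linarith [ht₀.1])
    -- Because `u ≤ S` and the other added terms are nonnegative, a positive maximum can occur only
    -- where the bump acts. This excludes both the lateral boundary, where `b = 0`, and the initial
    -- time, where `m = 0`.
    have hmb : 0 < m t₀ * bump c r x₀ := by
      have := hψ0 t₀
      simp only [hΦ] at hpos
      linarith
    have hx₀' : ‖x₀ - c‖ < 2 * r := by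
      by_contra! hcon
      rw [bump_eq_zero hr hcon] at hmb
      simp at hmb
    have ht₀' : ts < t₀ := by
      refine lt_of_le_of_ne ht₀.1 fun hcon => ?_
      rw [← hcon, hm0] at hmb
      simp at hmb
    have ht₀I := hI ht₀
    obtain ⟨M, hM⟩ : ∃ M, ∀ᵐ z, |u z t₀| ≤ M := by
      refine ⟨(eLpNormEssSup (fun z => u z t₀) volume).toReal, ?_⟩
      filter_upwards [ae_le_eLpNormEssSup (f := fun z => u z t₀) (μ := volume)] with z hz
      have h1 := (hsub.1.2 t₀ ht₀I).eLpNorm_ne_top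
      rw [eLpNorm_exponent_top] at h1
      simpa using (ENNReal.toReal_le_toReal (by simp) h1).2 hz
    -- Here `q` is the slope of `ψ` to the left of `t₀` and `τ` bounds the tail. At a time of `N`
    -- only some finite tail bound is known, but `ψ` is steep enough to take `q = τ`. At other times
    -- `q = 0` and the tail hypothesis applies.
    obtain ⟨q, τ, hq0, hτ0, hτq, htailτ, δ, hδ, hψδ⟩ : ∃ q τ : ℝ, 0 ≤ q ∧ 0 ≤ τ ∧
        τ * T ≤ e / 32 * h + q * T ∧
        (∀ K, IsAdmissibleKernel d s lam Lam ρ K →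
          ∫⁻ y, ENNReal.ofReal (u (x₀ + y) t₀ - S) * ENNReal.ofReal (K y)
            ≤ ENNReal.ofReal τ) ∧
        ∃ δ > 0, ∀ t ∈ Ioc (t₀ - δ) t₀, ψ t ≤ ψ t₀ - q * (t₀ - t) := by
      by_cases htN : t₀ ∈ N
      · have hM0 : 0 ≤ M := by
          obtain ⟨z, hz⟩ := hM.exists
          exact (abs_nonneg _).trans hz
        refine ⟨(M + |S|) * (C * r ^ (-(2 * s))), (M + |S|) * (C * r ^ (-(2 * s))), by positivity,
          by positivity, by linarith [show 0 < e / 32 * h by positivity], fun K hK => ?_,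
          hψs t₀ htN _⟩
        refine hK.lintegral_tail_le hr (hC lam ρ K hK r hr) (w := fun z => u z t₀ - S)
          (by positivity) ?_ fun z hz => ?_
        · filter_upwards [hM] with z hz
          linarith [le_abs_self (u z t₀), neg_le_abs S]
        · have : z ∈ Metric.ball c (4 * r) := by
            rw [mem_ball_iff_norm]
            have := norm_add_le (z - x₀) (x₀ - c)
            rw [sub_add_sub_cancel] at this
            linarith
          linarith [(hosc z this t₀ ht₀).2]
      · refine ⟨0, e / 32 * h * T⁻¹, le_rfl, by positivity, le_of_eq (by field_simp; simp),
          fun K hK => ?_, 1, one_pos, fun t ht => ?_⟩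
        · rw [← hTinv]
          exact htail t₀ ht₀ htN K hK x₀ hx₀'
        · simpa using hψm ht.2
    set ω := volume.real (Metric.ball (0 : Space d) 1) with hω
    have hωp : 0 < ω := volume_real_unit_ball_pos d
    obtain ⟨ε, hε, hεr, hε1, hεx, hεt, hεδ, hεs⟩ : ∃ ε : ℝ, 0 < ε ∧ ε ≤ r ∧ ε ≤ 1 ∧
        ε ≤ 2 * r - ‖x₀ - c‖ ∧ ε ≤ t₀ - ts ∧ ε ≤ δ ∧
        ε ≤ e / 32 * h / (2 * (κ * (2 * h) * ω * T)) := by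
      refine ⟨min r (min 1 (min (2 * r - ‖x₀ - c‖) (min (t₀ - ts) (min δ
        (e / 32 * h / (2 * (κ * (2 * h) * ω * T))))))), ?_, ?_⟩
      · have : 0 < 2 * r - ‖x₀ - c‖ := by linarith
        have : 0 < t₀ - ts := by linarith
        have : 0 < e / 32 * h / (2 * (κ * (2 * h) * ω * T)) := by positivity
        simp only [lt_min_iff]
        exact ⟨hr, one_pos, ‹_›, ‹_›, hδ, ‹_›⟩
      · simp
    have hball : ∀ z, ‖z - x₀‖ < ε → ‖z - c‖ < 2 * r := fun z hz => by
      have := norm_add_le (z - x₀) (x₀ - c)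
      rw [sub_add_sub_cancel] at this
      linarith
    have hslack : κ * (2 * h * volume.real (Metric.ball x₀ ε)) * T ≤ e / 32 * h / 2 := by
      have h1 : volume.real (Metric.ball x₀ ε) ≤ ε * ω := by
        rw [volume_real_ball _ hε]
        gcongr
        exact pow_le_of_le_one hε.le hε1 (by lia)
      rw [le_div_iff₀ (by positivity)] at hεs
      calc _ ≤ κ * (2 * h * (ε * ω)) * T := by gcongr
        _ ≤ _ := by linarith
    set Mx := Φ (x₀, t₀) with hMx
    set a := S + κ₀ * (t₀ - ts) + ψ t₀ + Mx with ha
    have hSa : S ≤ a := by linarith [hψ0 t₀]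
    have hu0 : u x₀ t₀ = a - m t₀ * bump c r x₀ := by
      simp only [ha, hMx, hΦ]; ring
    have hupper : ∀ z, ‖z - c‖ < 2 * r → ∀ t ∈ Icc ts t₁,
        u z t ≤ S + κ₀ * (t - ts) + ψ t + Mx - m t * bump c r z := fun z hz t ht => by
      have h1 : Φ (z, t) ≤ Mx := hmax ⟨mem_closedBall_iff_norm.2 hz.le, ht⟩
      simp only [hΦ] at h1
      linarith
    set p := bumpRoot c r x₀ with hp
    have hp0 : 0 ≤ p := bumpRoot_nonneg c r x₀
    have hp1 : p ≤ 1 := bumpRoot_le_one c r x₀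
    have hwm : AEStronglyMeasurable fun z => u z t₀ := (hsub.1.2 t₀ ht₀I).1
    set γ : ℝ := if 3 / 2 * r ≤ ‖x₀ - c‖ then g₀ else 0 with hγ
    have hIcc : ∀ t ∈ Ioc (t₀ - ε) t₀, t ∈ Icc ts t₁ := fun t ht =>
      ⟨by linarith [ht.1], ht.2.trans ht₀.2⟩
    have hcontact := hsub.contact_le hne (c := c) (r := r) (x₀ := x₀) (t₀ := t₀) (ε := ε) hr
      (hΩ (hsub24 hx₀)) ht₀I hε
      (fun z hz => ⟨hΩ (hsub24 (mem_closedBall_iff_norm.2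
        (hball z.1 (mem_ball_iff_norm.1 hz.1)).le)), hI (hIcc z.2 hz.2)⟩)
      hball hmd hmt (a := a) (q := κ₀ + q) hu0
      (fun z hz t ht => by
        have h1 := hupper z (hball z hz) t (hIcc t ht)
        have h2 := hψδ t ⟨by linarith [ht.1], ht.2⟩
        simp only [ha]
        linarith)
      (X := 3 * m t₀ * p * C / T + τ - m t₀ * γ / T
        - κ * (g t₀ - 2 * h * volume.real (Metric.ball x₀ ε) - m t₀ * V))
      (fun K hK v hv1 hv2 => by
        have h1 := hK.nonlocalOp_touching_le hs0 hs1 hlam hLam hρ hrn hρr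
          (hC lam ρ K hK r hr) hx₀' hmt hSa hwm hM hε hεr
          (fun z hz => by
            have := hupper z hz t₀ ht₀
            simp only [ha]
            linarith) hv1 hv2 hτ0 (htailτ K hK) hκp.le
          (le_lower_bound hlam hr (by linarith) c)
        have h2 := setIntegral_gap_ge (x₀ := x₀) (ε := ε) hmt hh.le hwm
          (fun x hx => hosc' x hx t₀ ht₀)
        have h3 := mul_le_mul_of_nonneg_left h2 hκp.le
        have h4 : (if 3 / 2 * r ≤ ‖x₀ - c‖ then
              m t₀ / 2 * (lam * (4 * r) ^ (-(d : ℝ) - 2 * s)) else 0)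
            * volume.real (Metric.ball (0 : Space d) (r / 2)) = m t₀ * γ / T := by
          rw [hγ]
          split_ifs
          · rw [mul_div_assoc, hg₀, ← gain_scaling hr]; ring
          · simp
        rw [h4, hTinv] at h1
        refine h1.trans ?_
        have h5 : 3 * m t₀ * bumpRoot c r x₀ * (C * T⁻¹) = 3 * m t₀ * p * C / T := by
          rw [hp]; ring
        rw [h5]
        linarith)
    beta_reduce at hcontact
    rw [hcle t₀ ht₀] at hcontact
    have hDg : D * (m t₀ * ‖bumpGrad c r x₀‖) ≤ 2 * D₀ * (m t₀ * p) / T := by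
      rcases le_total 0 D with h0 | h0
      · have h1 : D / r ≤ D₀ / T := by rwa [div_le_div_iff₀ hr hTp]
        calc _ ≤ D * (m t₀ * (2 * p / r)) := by
              gcongr; exact norm_bumpGrad_le hr hx₀'.le
          _ = D / r * (2 * (m t₀ * p)) := by ring
          _ ≤ D₀ / T * (2 * (m t₀ * p)) := by gcongr
          _ = _ := by ring
      · exact (mul_nonpos_of_nonpos_of_nonneg h0 (by positivity)).trans (by positivity)
    have hb : bump c r x₀ = p ^ 2 := rfl
    have hdamp := damping_absorbs (C := C') (by positivity) hg₀p ha₀p ha₀g hp0 hp1 hβ₀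
      (P := 3 / 2 * r ≤ ‖x₀ - c‖) (fun hP => by
        have := le_bumpRoot (θ := 3 / 2) (c := c) hr (not_le.1 hP).le
        norm_num at this ⊢
        linarith)
    rw [← hγ] at hdamp
    have hgt := hg0 t₀ ht₀
    have hp2 : p ^ 2 ≤ 1 := pow_le_one₀ hp0 hp1
    -- The source of `m'` enters multiplied by `b ≤ 1`, whereas the gap lowers the nonlocal operator
    -- by the full `κ g`.
    have hκg : κ * g t₀ * p ^ 2 ≤ κ * g t₀ := mul_le_of_le_one_right (by positivity) hp2
    have hdm := mul_le_mul_of_nonneg_left hdamp hmt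
    rw [hb] at hcontact
    have hκ₀T : κ₀ * T = 3 * (e / 32) * h := by rw [hκ₀]; field_simp
    -- All terms containing `m` are absorbed by `hdamp`, including `κ m V T = a₀ m` from the gap
    -- estimate. The remainder reads `3 ε₀ h ≤ (5/2) ε₀ h`, a contradiction.
    have key : (κ₀ + q) * T ≤ A * T + τ * T
        + κ * (2 * h * volume.real (Metric.ball x₀ ε)) * T := by
      have h1 := mul_le_mul_of_nonneg_right (hcontact.trans (add_le_add_right hDg _)) hTp.le
      have e1 : (κ₀ + q - (κ * g t₀ - β₀ / T * m t₀) * p ^ 2) * T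
          = (κ₀ + q) * T - κ * g t₀ * p ^ 2 * T + m t₀ * (β₀ * p ^ 2) := by
        field_simp; ring
      have e2 : (A + (3 * m t₀ * p * C / T + τ - m t₀ * γ / T
          - κ * (g t₀ - 2 * h * volume.real (Metric.ball x₀ ε) - m t₀ * V))
          + 2 * D₀ * (m t₀ * p) / T) * T
          = A * T + τ * T + κ * (2 * h * volume.real (Metric.ball x₀ ε)) * T - κ * g t₀ * T
            + m t₀ * (C' * p + a₀ - γ) := by
        have : κ * (m t₀ * V) * T = m t₀ * a₀ := by
          rw [mul_left_comm, hκV]; field_simp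
        have e3 : (3 * m t₀ * p * C / T + τ - m t₀ * γ / T) * T
          = 3 * m t₀ * p * C + τ * T - m t₀ * γ := by field_simp
        have e4 : 2 * D₀ * (m t₀ * p) / T * T = 2 * D₀ * (m t₀ * p) := by field_simp
        rw [hC']
        linear_combination e3 + e4 + this
      rw [e1, e2] at h1
      have h2 := mul_le_mul_of_nonneg_right hκg hTp.le
      linarith
    have : 0 < e / 32 * h := by positivity
    rw [add_mul, hκ₀T] at key
    linarith
  intro x hx t ht
  have htI : t ∈ Icc ts t₁ := ⟨by linarith [ht.1], ht.2⟩
  have h1 := hmain (x, t) ⟨Metric.ball_subset_closedBall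
    (Metric.ball_subset_ball (by linarith) hx), htI⟩
  simp only [hΦ] at h1
  have h2 := hmlow (t₁ - T / 2) t (by linarith) ht.1
  have h3 : ∫ τ in ts..(t₁ - T / 2), κ * g (clamp τ)
      = κ * ∫ τ in ts..(t₁ - T / 2), g τ := by
    rw [← intervalIntegral.integral_const_mul]
    refine intervalIntegral.integral_congr fun τ hτ => ?_
    rw [uIcc_of_le (by linarith)] at hτ
    rw [hcle τ ⟨hτ.1, by linarith [hτ.2]⟩]
  have h4 : a₀ * h / 2 ≤ κ * ∫ τ in ts..(t₁ - T / 2), g τ := by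
    refine le_trans (le_of_eq ?_) (mul_le_mul_of_nonneg_left hmean hκp.le)
    rw [hκ]; field_simp
  have h5 : Real.exp (-β₀) ≤ Real.exp (-(β₀ / T * (t - ts))) := by
    refine Real.exp_le_exp.2 (neg_le_neg ?_)
    rw [div_mul_eq_mul_div, div_le_iff₀ hTp]
    exact mul_le_mul_of_nonneg_left (by linarith [ht.2]) hβ₀p
  have h6 : e * h / 2 ≤ m t := by
    refine le_trans ?_ h2
    rw [h3]
    calc e * h / 2 = Real.exp (-β₀) * (a₀ * h / 2) := by rw [he]; ring
      _ ≤ _ := by gcongr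
  have h7 : 9 / 16 ≤ bump c r x := by
    have := le_bumpRoot (θ := 1) (c := c) (x := x) hr
      (by rw [one_mul]; exact (mem_ball_iff_norm.1 hx).le)
    norm_num at this
    unfold bump
    nlinarith
  have h8 : e * h / 2 * (9 / 16) ≤ m t * bump c r x :=
    mul_le_mul h6 h7 (by norm_num) (hmnn t htI.1)
  have h9 : κ₀ * (t - ts) ≤ 3 * (e / 32) * h := by
    calc _ ≤ κ₀ * T := mul_le_mul_of_nonneg_left (by linarith [ht.2]) hκ₀p.le
      _ = _ := by rw [hκ₀]; field_simp
  have h10 := hψe t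
  have : 0 < e * h := by positivity
  linarith

/-! ### Decay of oscillation and propagation of tails -/

/-- Bound on the tails of the positive part of `u - S`, outside a null set `N` of times. -/
def TailBound {d : ℕ} (s lam Lam ρ E : ℝ) (N : Set ℝ) (c : Space d) (t₁ r S h : ℝ)
    (u : Space d → ℝ → ℝ) : Prop :=
  ∀ t ∈ Icc (t₁ - r ^ (2 * s)) t₁, t ∉ N → ∀ K, IsAdmissibleKernel d s lam Lam ρ K →
    ∀ x, ‖x - c‖ < 2 * r → ∫⁻ y, ENNReal.ofReal (u (x + y) t - S) * ENNReal.ofReal (K y)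
      ≤ ENNReal.ofReal (E * h * r ^ (-(2 * s)))

/-- Oscillation at most `2 * h` at scale `r`, together with the tails on both sides. -/
def OscBound {d : ℕ} (s lam Lam ρ E : ℝ) (N : Set ℝ) (c : Space d) (t₁ r h : ℝ)
    (u : Space d → ℝ → ℝ) : Prop :=
  ∃ S, (∀ x ∈ Metric.ball c (4 * r), ∀ t ∈ Icc (t₁ - r ^ (2 * s)) t₁,
      S - 2 * h ≤ u x t ∧ u x t ≤ S) ∧
    TailBound s lam Lam ρ E N c t₁ r S h u ∧
    TailBound s lam Lam ρ E N c t₁ r (2 * h - S) h fun x t => -u x t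

theorem OscBound.of_neg {d : ℕ} {s lam Lam ρ E : ℝ} {N : Set ℝ} {c : Space d} {t₁ r h : ℝ}
    {u : Space d → ℝ → ℝ} (H : OscBound s lam Lam ρ E N c t₁ r h fun x t => -u x t) :
    OscBound s lam Lam ρ E N c t₁ r h u := by
  obtain ⟨S, h1, h2, h3⟩ := H
  refine ⟨2 * h - S, fun x hx t ht => ?_, ?_, ?_⟩
  · have := h1 x hx t ht
    constructor <;> linarith
  · simpa using h3
  · simpa using h2

/-- Lowering the level gives `(u - S')⁺ ≤ (u - S)⁺ + (S - S')`, and the left side vanishes on the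
ball of radius `4r'`. The constant excess thus lives at distance at least `r'` from `x` and has tail
of order `r'^(-2s)`. No pointwise growth bound outside the cylinder is needed. -/
theorem TailBound.step {d : ℕ} {s lam Lam ρ E : ℝ} {N : Set ℝ} {c : Space d}
    {t₁ r S S' h h' r' C : ℝ} {u : Space d → ℝ → ℝ} (hE : 0 ≤ E) (hh : 0 ≤ h)
    (H : TailBound s lam Lam ρ E N c t₁ r S h u) (hs0 : 0 < s)
    (hC : ∀ K, IsAdmissibleKernel d s lam Lam ρ K →
      Integrable (fun y => kernelWeight s r' y * K y) ∧
        ∫ y, kernelWeight s r' y * K y ≤ C * r' ^ (-(2 * s))) (hC0 : 0 ≤ C)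
    (hr' : 0 < r') (hrr' : r' ≤ r) (hS : S' ≤ S) (hSh : S - S' ≤ 2 * (h - h'))
    (hu : ∀ x ∈ Metric.ball c (4 * r'), ∀ t ∈ Icc (t₁ - r' ^ (2 * s)) t₁, u x t ≤ S')
    (hE' : E * h * r ^ (-(2 * s)) + 2 * (h - h') * (C * r' ^ (-(2 * s)))
      ≤ E * h' * r' ^ (-(2 * s))) :
    TailBound s lam Lam ρ E N c t₁ r' S' h' u := by
  have hr : 0 < r := hr'.trans_le hrr'
  intro t ht htN K hK x hx
  have ht' : t ∈ Icc (t₁ - r ^ (2 * s)) t₁ := by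
    have : r' ^ (2 * s) ≤ r ^ (2 * s) := by gcongr
    exact ⟨by linarith [ht.1], ht.2⟩
  have h1 := H t ht' htN K hK x (by linarith)
  set w : Space d → ℝ := (Metric.ball c (4 * r'))ᶜ.indicator fun _ => S - S' with hw
  have hwm : Measurable w := measurable_const.indicator measurableSet_ball.compl
  have hwx : Measurable fun y => w (x + y) := hwm.comp (measurable_const_add x)
  have h2 : ∫⁻ y, ENNReal.ofReal (w (x + y)) * ENNReal.ofReal (K y)
      ≤ ENNReal.ofReal ((2 * (h - h')) * (C * r' ^ (-(2 * s)))) := by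
    refine hK.lintegral_tail_le hr' (hC K hK) (by linarith) (ae_of_all _ fun z => ?_)
      fun z hz => ?_
    · by_cases hz : z ∈ Metric.ball c (4 * r')
      · rw [hw, indicator_of_notMem (notMem_compl_iff.2 hz)]; linarith
      · rw [hw, indicator_of_mem hz]; exact hSh
    · have : z ∈ Metric.ball c (4 * r') := by
        rw [mem_ball_iff_norm]
        have := norm_add_le (z - x) (x - c)
        rw [sub_add_sub_cancel] at this
        linarith
      rw [hw, indicator_of_notMem (notMem_compl_iff.2 this)]
  calc _ ≤ ∫⁻ y, (ENNReal.ofReal (u (x + y) t - S) * ENNReal.ofReal (K y)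
        + ENNReal.ofReal (w (x + y)) * ENNReal.ofReal (K y)) := by
        refine lintegral_mono fun y => ?_
        rw [← add_mul]
        refine mul_le_mul_left ?_ _
        by_cases hz : x + y ∈ Metric.ball c (4 * r')
        · rw [ENNReal.ofReal_of_nonpos (by linarith [hu _ hz t ht])]
          exact zero_le
        · rw [hw, indicator_of_mem hz]
          refine le_trans (le_of_eq ?_) ENNReal.ofReal_add_le
          congr 1; ring
    _ = (∫⁻ y, ENNReal.ofReal (u (x + y) t - S) * ENNReal.ofReal (K y))
        + ∫⁻ y, ENNReal.ofReal (w (x + y)) * ENNReal.ofReal (K y) :=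
        lintegral_add_right _ (hwx.ennreal_ofReal.mul hK.measurable.ennreal_ofReal)
    _ ≤ _ := by
        refine (add_le_add h1 h2).trans ?_
        rw [← ENNReal.ofReal_add (by positivity)
          (mul_nonneg (by linarith) (by positivity))]
        exact ENNReal.ofReal_le_ofReal hE'

/-- Choice of the Hölder exponent. -/
theorem exists_holder_exponent {s θ E C σ : ℝ} (hs0 : 0 < s) (hθ : 0 < θ) (hE : 0 < E)
    (hσ0 : 0 < σ) (hσ1 : σ < 1) :
    ∃ α : ℝ, 0 < α ∧ α < 2 * s ∧ 2 - 2 * σ ^ α ≤ θ ∧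
      E * σ ^ (2 * s) + 2 * (1 - σ ^ α) * C ≤ E * σ ^ α := by
  -- At `α = 0`, where `σ^α = 1`, the required inequalities become `0 < θ`, `E σ^(2s) < E` and `0 <
  -- 2s`. Being strict, they persist for small positive `α`.
  have hc : Filter.Tendsto (fun α : ℝ => σ ^ α) (nhds 0) (nhds 1) := by
    have := (Real.continuousAt_const_rpow (a := σ) (b := 0) hσ0.ne').tendsto
    rwa [Real.rpow_zero] at this
  have hp : σ ^ (2 * s) < 1 := Real.rpow_lt_one hσ0.le hσ1 (by positivity)
  have h1 : ∀ᶠ α in nhds (0 : ℝ), 2 - 2 * σ ^ α < θ :=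
    ((hc.const_mul 2).const_sub 2).eventually_lt_const (by linarith)
  have h2 : ∀ᶠ α in nhds (0 : ℝ), E * σ ^ (2 * s) + 2 * (1 - σ ^ α) * C < E * σ ^ α :=
    (((hc.const_sub 1).const_mul 2).mul_const C |>.const_add (E * σ ^ (2 * s))).eventually_lt
      (hc.const_mul E) (by nlinarith)
  have h3 : ∀ᶠ α in nhds (0 : ℝ), α < 2 * s := eventually_lt_nhds (by positivity)
  obtain ⟨α, ⟨⟨ha, hb⟩, hd⟩, h0⟩ := ((((h1.and h2).and h3).filter_mono nhdsWithin_le_nhds).and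
    (self_mem_nhdsWithin (s := Ioi (0 : ℝ)))).exists
  exact ⟨α, h0, hd, ha.le, hb.le⟩

/-- The ratio places the next cylinder, including its ball of radius `4σr`, inside the region where
the growth lemma improves the bound: the ball of radius `r` and the second half of the time
interval. A power of `1/2` keeps the radii dyadic. -/
theorem exists_dyadic_ratio {s : ℝ} (hs0 : 0 < s) :
    ∃ k : ℕ, 4 * (1 / 2 : ℝ) ^ k ≤ 1 ∧ ((1 / 2 : ℝ) ^ k) ^ (2 * s) ≤ 1 / 2 := by
  obtain ⟨k, hk⟩ := exists_nat_ge (1 / (2 * s))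
  refine ⟨k + 2, ?_, ?_⟩
  · have : (1 / 2 : ℝ) ^ k ≤ 1 := pow_le_one₀ (by norm_num) (by norm_num)
    rw [pow_add]; linarith
  · rw [← Real.rpow_natCast, ← Real.rpow_mul (by norm_num)]
    calc _ ≤ (1 / 2 : ℝ) ^ (1 : ℝ) := by
          refine Real.rpow_le_rpow_of_exponent_ge (by norm_num) (by norm_num) ?_
          rw [div_le_iff₀ (by positivity)] at hk
          push_cast
          nlinarith
      _ = 1 / 2 := Real.rpow_one _

/-- The lower bound `S - 2h` is kept and the upper level drops to `S - 2h + 2σ^α h`, which is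
allowed because `2 - 2σ^α ≤ θ`. Accordingly the level for `-u` is unchanged, and only the level for
`u` moves. -/
theorem GrowthProperty.oscBound_of_mean {d : ℕ} {s lam Lam D₀ θ E C : ℝ}
    (G : GrowthProperty d s lam Lam D₀ θ E) (hs0 : 0 < s) (hE : 0 < E) (hC0 : 0 ≤ C)
    (hC : ∀ (lam ρ : ℝ) (K : Space d → ℝ), IsAdmissibleKernel d s lam Lam ρ K →
      ∀ r : ℝ, 0 < r → Integrable (fun y => kernelWeight s r y * K y) ∧
        ∫ y, kernelWeight s r y * K y ≤ C * r ^ (-(2 * s)))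
    {σ α : ℝ} (hσ0 : 0 < σ) (hσ4 : 4 * σ ≤ 1) (hσs : σ ^ (2 * s) ≤ 1 / 2) (hα : 0 < α)
    (hαθ : 2 - 2 * σ ^ α ≤ θ)
    (hαE : E * σ ^ (2 * s) + 2 * (1 - σ ^ α) * C ≤ E * σ ^ α)
    {ρ D A : ℝ} {Ω : Set (Space d)} {I : Set ℝ} {u : Space d → ℝ → ℝ} {r : ℝ} {n : ℤ}
    {c : Space d} {t₁ S h : ℝ} {N : Set ℝ} (hρ : 0 ≤ ρ) (hρr : ρ ≤ r) (hrn : r = 2 ^ n)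
    (hne : (kernelClass d s lam Lam ρ).Nonempty) (hD : D * r ^ (2 * s) ≤ D₀ * r)
    (hsub : IsViscositySubsolution (fun w x => pucciSup s lam Lam ρ w x + D * ‖gradient w x‖)
      (fun _ _ => A) Ω I u)
    (hcont : ContinuousOn (Function.uncurry u) (Ω ×ˢ I))
    (hΩ : Metric.ball c (4 * r) ⊆ Ω) (hI : Icc (t₁ - r ^ (2 * s)) t₁ ⊆ I)
    (hh : 0 < h) (hA : A * r ^ (2 * s) ≤ E * h) (hN : volume N = 0)
    (hosc : ∀ x ∈ Metric.ball c (4 * r), ∀ t ∈ Icc (t₁ - r ^ (2 * s)) t₁,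
      S - 2 * h ≤ u x t ∧ u x t ≤ S)
    (htail : TailBound s lam Lam ρ E N c t₁ r S h u)
    (htail' : TailBound s lam Lam ρ E N c t₁ r (2 * h - S) h fun x t => -u x t)
    (hmean : h * volume.real (Metric.ball c r) * r ^ (2 * s) / 2 ≤
        ∫ t in (t₁ - r ^ (2 * s))..(t₁ - r ^ (2 * s) / 2), ∫ x in Metric.ball c r, (S - u x t)) :
    OscBound s lam Lam ρ E N c t₁ (σ * r) (σ ^ α * h) u := by
  have hr : 0 < r := by rw [hrn]; positivity
  have hgrow := G ρ D A Ω I u r n c t₁ S h N hρ hρr hrn hne hD hsub hcont hΩ hI hh hA hosc hN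
    htail hmean
  have hT : 0 < r ^ (2 * s) := by positivity
  have hTσ : (σ * r) ^ (2 * s) = σ ^ (2 * s) * r ^ (2 * s) := Real.mul_rpow hσ0.le hr.le
  have hT' : (σ * r) ^ (2 * s) ≤ r ^ (2 * s) / 2 := by rw [hTσ]; nlinarith
  have hrr' : σ * r ≤ r := by nlinarith
  have hball4 : Metric.ball c (4 * (σ * r)) ⊆ Metric.ball c r :=
    Metric.ball_subset_ball (by nlinarith)
  have hball : Metric.ball c (4 * (σ * r)) ⊆ Metric.ball c (4 * r) :=
    Metric.ball_subset_ball (by linarith)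
  have hσα : σ ^ α ≤ 1 := Real.rpow_le_one hσ0.le (by linarith) hα.le
  have hσα0 : 0 < σ ^ α := by positivity
  have hIcc : ∀ t ∈ Icc (t₁ - (σ * r) ^ (2 * s)) t₁, t ∈ Icc (t₁ - r ^ (2 * s)) t₁ ∧
      t ∈ Icc (t₁ - r ^ (2 * s) / 2) t₁ := fun t ht =>
    ⟨⟨by linarith [ht.1], ht.2⟩, ⟨by linarith [ht.1], ht.2⟩⟩
  have hE' : E * h * r ^ (-(2 * s)) + 2 * (h - σ ^ α * h) * (C * (σ * r) ^ (-(2 * s)))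
      ≤ E * (σ ^ α * h) * (σ * r) ^ (-(2 * s)) := by
    rw [Real.rpow_neg hr.le, Real.rpow_neg (by positivity), hTσ, ← sub_nonneg]
    have h1 : 0 ≤ (E * σ ^ α - (E * σ ^ (2 * s) + 2 * (1 - σ ^ α) * C))
        * (h * (σ ^ (2 * s) * r ^ (2 * s))⁻¹) :=
      mul_nonneg (by linarith) (by positivity)
    refine h1.trans (le_of_eq ?_)
    have : σ ^ (2 * s) ≠ 0 := by positivity
    field_simp
  have hC' : ∀ K, IsAdmissibleKernel d s lam Lam ρ K →
      Integrable (fun y => kernelWeight s (σ * r) y * K y) ∧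
        ∫ y, kernelWeight s (σ * r) y * K y ≤ C * (σ * r) ^ (-(2 * s)) :=
    fun K hK => hC lam ρ K hK (σ * r) (by positivity)
  have hup : ∀ x ∈ Metric.ball c (4 * (σ * r)), ∀ t ∈ Icc (t₁ - (σ * r) ^ (2 * s)) t₁,
      u x t ≤ S - 2 * h + 2 * (σ ^ α * h) := fun x hx t ht => by
    have h1 := hgrow x (hball4 hx) t (hIcc t ht).2
    nlinarith
  have hlow : ∀ x ∈ Metric.ball c (4 * (σ * r)), ∀ t ∈ Icc (t₁ - (σ * r) ^ (2 * s)) t₁,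
      -u x t ≤ 2 * (σ ^ α * h) - (S - 2 * h + 2 * (σ ^ α * h)) := fun x hx t ht => by
    have h1 := (hosc x (hball hx) t (hIcc t ht).1).1
    linarith
  refine ⟨S - 2 * h + 2 * (σ ^ α * h), fun x hx t ht => ⟨by linarith [hlow x hx t ht],
    hup x hx t ht⟩, ?_, ?_⟩
  · exact htail.step hE.le hh.le hs0 hC' hC0 (by positivity) hrr' (by nlinarith) (by linarith)
      hup hE'
  · exact htail'.step hE.le hh.le hs0 hC' hC0 (by positivity) hrr' (by linarith) (by nlinarith)
      hlow hE'

/-- The dichotomy: if `S - u` averages less than `h` over the first half, then `u - (S - 2h)`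
averages more than `h`, and the growth lemma applies to `-u` with level `2h - S`. -/
theorem GrowthProperty.oscBound_step {d : ℕ} {s lam Lam D₀ θ E C : ℝ}
    (G : GrowthProperty d s lam Lam D₀ θ E) (hs0 : 0 < s) (hE : 0 < E) (hC0 : 0 ≤ C)
    (hC : ∀ (lam ρ : ℝ) (K : Space d → ℝ), IsAdmissibleKernel d s lam Lam ρ K →
      ∀ r : ℝ, 0 < r → Integrable (fun y => kernelWeight s r y * K y) ∧
        ∫ y, kernelWeight s r y * K y ≤ C * r ^ (-(2 * s)))
    {σ α : ℝ} (hσ0 : 0 < σ) (hσ4 : 4 * σ ≤ 1) (hσs : σ ^ (2 * s) ≤ 1 / 2) (hα : 0 < α)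
    (hαθ : 2 - 2 * σ ^ α ≤ θ)
    (hαE : E * σ ^ (2 * s) + 2 * (1 - σ ^ α) * C ≤ E * σ ^ α)
    {ρ D A : ℝ} {Ω : Set (Space d)} {I : Set ℝ} {u : Space d → ℝ → ℝ} {r : ℝ} {n : ℤ}
    {c : Space d} {t₁ h : ℝ} {N : Set ℝ} (hρ : 0 ≤ ρ) (hρr : ρ ≤ r) (hrn : r = 2 ^ n)
    (hne : (kernelClass d s lam Lam ρ).Nonempty) (hD : D * r ^ (2 * s) ≤ D₀ * r)
    (hsub : IsViscositySubsolution (fun w x => pucciSup s lam Lam ρ w x + D * ‖gradient w x‖)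
      (fun _ _ => A) Ω I u)
    (hsub' : IsViscositySubsolution (fun w x => pucciSup s lam Lam ρ w x + D * ‖gradient w x‖)
      (fun _ _ => A) Ω I fun x t => -u x t)
    (hcont : ContinuousOn (Function.uncurry u) (Ω ×ˢ I))
    (hΩ : Metric.ball c (4 * r) ⊆ Ω) (hI : Icc (t₁ - r ^ (2 * s)) t₁ ⊆ I)
    (hh : 0 < h) (hA : A * r ^ (2 * s) ≤ E * h) (hN : volume N = 0)
    (H : OscBound s lam Lam ρ E N c t₁ r h u) :
    OscBound s lam Lam ρ E N c t₁ (σ * r) (σ ^ α * h) u := by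
  have hr : 0 < r := by rw [hrn]; positivity
  have hT : 0 < r ^ (2 * s) := by positivity
  obtain ⟨S, hosc, ht, ht'⟩ := H
  by_cases hmean : h * volume.real (Metric.ball c r) * r ^ (2 * s) / 2 ≤
      ∫ t in (t₁ - r ^ (2 * s))..(t₁ - r ^ (2 * s) / 2), ∫ x in Metric.ball c r, (S - u x t)
  · exact G.oscBound_of_mean hs0 hE hC0 hC hσ0 hσ4 hσs hα hαθ hαE hρ hρr hrn hne hD hsub hcont hΩ
      hI hh hA hN hosc ht ht' hmean
  · refine OscBound.of_neg (G.oscBound_of_mean (S := 2 * h - S) hs0 hE hC0 hC hσ0 hσ4 hσs hα hαθ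
      hαE hρ hρr hrn hne hD hsub' hcont.neg hΩ hI hh hA hN (fun x hx t ht => ?_) ht' ?_ ?_)
    · have := hosc x hx t ht
      constructor <;> linarith
    · simpa using ht
    · have hsub14 : Metric.ball c r ⊆ Metric.ball c (4 * r) :=
        Metric.ball_subset_ball (by linarith)
      have hgc : ContinuousOn (fun t => ∫ x in Metric.ball c r, (S - u x t))
          (Icc (t₁ - r ^ (2 * s)) t₁) := by
        refine continuousOn_setIntegral_slice (B := 2 * h)
          (hcont.mono (prod_mono (hsub14.trans hΩ) hI)) fun x hx t ht => ?_
        have := hosc x (hsub14 hx) t ht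
        rw [abs_le]
        constructor <;> linarith
      have hle : t₁ - r ^ (2 * s) ≤ t₁ - r ^ (2 * s) / 2 := by linarith
      have hsubI : Icc (t₁ - r ^ (2 * s)) (t₁ - r ^ (2 * s) / 2) ⊆ Icc (t₁ - r ^ (2 * s)) t₁ :=
        Icc_subset_Icc_right (by linarith)
      have hslice : ∀ t ∈ Icc (t₁ - r ^ (2 * s)) t₁,
          ∫ x in Metric.ball c r, (2 * h - S - -u x t) =
            2 * h * volume.real (Metric.ball c r) - ∫ x in Metric.ball c r, (S - u x t) := by
        intro t ht
        have hint : IntegrableOn (fun x => S - u x t) (Metric.ball c r) := by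
          refine Measure.integrableOn_of_bounded (M := 2 * h) measure_ball_lt_top.ne
            (aestronglyMeasurable_const.sub (hsub.1.2 t (hI ht)).1) ?_
          refine (ae_restrict_iff' measurableSet_ball).2 (ae_of_all _ fun x hx => ?_)
          have := hosc x (hsub14 hx) t ht
          rw [Real.norm_eq_abs, abs_le]
          constructor <;> linarith
        have : ∀ x, 2 * h - S - -u x t = 2 * h - (S - u x t) := fun x => by ring
        simp_rw [this]
        have hcst : IntegrableOn (fun _ : Space d => 2 * h) (Metric.ball c r) :=
          integrableOn_const measure_ball_lt_top.ne
        rw [integral_sub hcst hint, setIntegral_const,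
          smul_eq_mul, mul_comm]
      have heq : ∫ t in (t₁ - r ^ (2 * s))..(t₁ - r ^ (2 * s) / 2),
          ∫ x in Metric.ball c r, (2 * h - S - -u x t) =
          2 * h * volume.real (Metric.ball c r) * (r ^ (2 * s) / 2) -
            ∫ t in (t₁ - r ^ (2 * s))..(t₁ - r ^ (2 * s) / 2),
              ∫ x in Metric.ball c r, (S - u x t) := by
        rw [intervalIntegral.integral_congr (g := fun t =>
          2 * h * volume.real (Metric.ball c r) - ∫ x in Metric.ball c r, (S - u x t))
          (fun t ht => hslice t (hsubI (by rwa [uIcc_of_le hle] at ht))),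
          intervalIntegral.integral_sub (by simp)
          ((hgc.mono hsubI).intervalIntegrable_of_Icc hle), intervalIntegral.integral_const,
          smul_eq_mul]
        ring
      rw [heq]
      linarith [not_le.1 hmean]

/-! ### From oscillation decay to the Hölder estimate -/

/-- The fraction of the radius on which the iteration starts. -/
theorem exists_initial_fraction {s : ℝ} (hs0 : 0 < s) :
    ∃ κ : ℝ, 0 < κ ∧ κ ≤ 3 / 16 ∧ ∀ R r : ℝ, 0 < R → 0 ≤ r → r ≤ κ * R →
      (R / 4) ^ (2 * s) + r ^ (2 * s) ≤ R ^ (2 * s) := by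
  have h4 : (1 / 4 : ℝ) ^ (2 * s) < 1 :=
    Real.rpow_lt_one (by norm_num) (by norm_num) (by positivity)
  set b := 1 - (1 / 4 : ℝ) ^ (2 * s) with hb
  have hb0 : 0 < b := by linarith
  -- The bound `3/16` keeps balls of radius `4κR` centred in the ball of radius `R/4` inside that of
  -- radius `R`; the other entry does the same for the time intervals.
  refine ⟨min (3 / 16) (b ^ (1 / (2 * s))), lt_min (by norm_num) (by positivity),
    min_le_left _ _, fun R r hR hr hrR => ?_⟩
  have h1 : r ≤ b ^ (1 / (2 * s)) * R :=
    hrR.trans (mul_le_mul_of_nonneg_right (min_le_right _ _) hR.le)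
  have h2 : r ^ (2 * s) ≤ b * R ^ (2 * s) := by
    calc r ^ (2 * s) ≤ (b ^ (1 / (2 * s)) * R) ^ (2 * s) := by gcongr
      _ = b * R ^ (2 * s) := by
        rw [Real.mul_rpow (by positivity) hR.le, ← Real.rpow_mul hb0.le,
          one_div_mul_cancel (by positivity), Real.rpow_one]
  have h3 : (R / 4) ^ (2 * s) = (1 / 4 : ℝ) ^ (2 * s) * R ^ (2 * s) := by
    rw [← Real.mul_rpow (by norm_num) hR.le]; congr 1; ring
  rw [h3]
  linarith

theorem exists_dyadic_near {a : ℝ} (ha : 0 < a) : ∃ n : ℤ, (2 : ℝ) ^ n ≤ a ∧ a / 2 < 2 ^ n := by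
  obtain ⟨n, h1, h2⟩ := exists_mem_Ico_zpow ha one_lt_two
  rw [zpow_add₀ two_ne_zero, zpow_one] at h2
  exact ⟨n, h1, by linarith⟩

theorem parDist_comm {d : ℕ} (s : ℝ) (p q : Space d × ℝ) : parDist s p q = parDist s q p := by
  unfold parDist
  rw [norm_sub_rev, abs_sub_comm]

theorem abs_sub_le_of_parDist_le {d : ℕ} {s r : ℝ} (hs0 : 0 < s) {p q : Space d × ℝ}
    (h : parDist s p q ≤ r) : |p.2 - q.2| ≤ r ^ (2 * s) := by
  have h1 : |p.2 - q.2| ^ (1 / (2 * s)) ≤ r := (le_max_right _ _).trans h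
  calc |p.2 - q.2| = (|p.2 - q.2| ^ (1 / (2 * s))) ^ (2 * s) := by
        rw [← Real.rpow_mul (abs_nonneg _), one_div_mul_cancel (by positivity), Real.rpow_one]
    _ ≤ _ := Real.rpow_le_rpow (by positivity) h1 (by positivity)

/-- The partial Hölder estimate, for a drift that is bounded at all scales. -/
theorem exists_partialHolder (d : ℕ) (hd : 1 ≤ d) {s lam Lam : ℝ} (hs0 : 0 < s) (hs1 : s < 1)
    (hlam : 0 < lam) (hLam : 0 < Lam) {D₀ : ℝ} (hD₀ : 0 ≤ D₀) :
    ∃ α : ℝ, 0 < α ∧ α < 2 * s ∧ ∃ C : ℝ, 0 < C ∧ ∀ ρ R A D : ℝ, 0 ≤ ρ →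
      (kernelClass d s lam Lam ρ).Nonempty → 2 * ρ < R → 0 ≤ A →
      (∀ r, 0 < r → r ≤ R → D * r ^ (2 * s) ≤ D₀ * r) → ∀ u : Space d → ℝ → ℝ,
      IsViscositySubsolution (fun w x => pucciSup s lam Lam ρ w x + D * ‖gradient w x‖)
        (fun _ _ => A) (Metric.ball 0 R) (timeInterval s R) u →
      IsViscositySubsolution (fun w x => pucciSup s lam Lam ρ w x + D * ‖gradient w x‖)
        (fun _ _ => A) (Metric.ball 0 R) (timeInterval s R) (fun x t => -u x t) →
      ContinuousOn (Function.uncurry u) (Metric.ball 0 R ×ˢ timeInterval s R) →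
      PartialHolderEstimate s ρ R A α C u := by
  obtain ⟨Cw, hCw0, hCw⟩ := exists_kernelWeight_bound d hs0 hs1 hLam
  obtain ⟨θ, E, hθ0, hθ1, hE, G⟩ := exists_growthProperty d hd hs0 hs1 hlam hLam hD₀
  obtain ⟨k, hσ4, hσs⟩ := exists_dyadic_ratio hs0
  set σ : ℝ := (1 / 2) ^ k with hσ
  have hσ0 : 0 < σ := by positivity
  have hσ1 : σ < 1 := by linarith
  obtain ⟨α, hα0, hα2, hαθ, hαE⟩ := exists_holder_exponent (C := Cw) hs0 hθ0 hE hσ0 hσ1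
  obtain ⟨κ, hκ0, hκ1, hκ⟩ := exists_initial_fraction hs0
  refine ⟨α, hα0, hα2, 2 * (2 / (σ * κ)) ^ α * (1 + 1 / E), by positivity, ?_⟩
  intro ρ R A D hρ hne hρR hA hD u hsub hsub' hcont
  have hR : 0 < R := by linarith
  obtain ⟨n₀, hn1, hn2⟩ := exists_dyadic_near (show 0 < κ * R by positivity)
  set r₀ : ℝ := 2 ^ n₀ with hr₀
  have hr₀p : 0 < r₀ := by positivity
  have hr₀R : 4 * r₀ ≤ 3 / 4 * R := by nlinarith
  set B := normLInfty (timeInterval s R) u with hB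
  have hB0 : 0 ≤ B := ENNReal.toReal_nonneg
  have huB : ∀ x ∈ Metric.ball (0 : Space d) R, ∀ t ∈ timeInterval s R, |u x t| ≤ B :=
    fun x hx t ht => hsub.1.abs_le_of_continuousOn Metric.isOpen_ball hcont hx ht
  obtain ⟨N, hN, hNB⟩ : ∃ N : Set ℝ, volume N = 0 ∧ ∀ t ∈ timeInterval s R, t ∉ N →
      ∀ᵐ x, |u x t| ≤ B := hsub.1.exists_null_slice_le measurableSet_Ioc
  -- The second summand gives `A r₀^(2s) ≤ E h₀` at the first scale. Smaller scales inherit the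
  -- condition because `σ^(2s) ≤ σ^α`.
  set h₀ := B + A * r₀ ^ (2 * s) / E with hh₀
  have hh₀0 : 0 ≤ h₀ := by positivity
  -- oscillation at all scales, with an arbitrarily small excess to keep it positive
  have hosc : ∀ δ > 0, ∀ p ∈ parCyl d s (R / 4), ∀ j : ℕ, (∀ i < j, ρ ≤ σ ^ i * r₀) →
      OscBound s lam Lam ρ E N p.1 p.2 (σ ^ j * r₀) ((σ ^ α) ^ j * (h₀ + δ)) u := by
    intro δ hδ p hp j
    have hp1 : ‖p.1‖ < R / 4 := mem_ball_zero_iff.1 hp.1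
    have hΩ : Metric.ball p.1 (4 * r₀) ⊆ Metric.ball 0 R := fun x hx => by
      rw [mem_ball_iff_norm] at hx
      rw [mem_ball_zero_iff]
      have := norm_add_le (x - p.1) p.1
      rw [sub_add_cancel] at this
      linarith
    have hI : Icc (p.2 - r₀ ^ (2 * s)) p.2 ⊆ timeInterval s R := fun t ht => by
      have h1 := hκ R r₀ hR hr₀p.le hn1
      have h2 := hp.2.1
      exact ⟨by linarith [ht.1], ht.2.trans hp.2.2⟩
    have hAh : A * r₀ ^ (2 * s) / E ≤ h₀ + δ := by linarith
    induction j with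
    | zero =>
      intro _
      simp only [pow_zero, one_mul]
      have hle : ∀ x ∈ Metric.ball p.1 (4 * r₀), ∀ t ∈ Icc (p.2 - r₀ ^ (2 * s)) p.2,
          |u x t| ≤ h₀ + δ := fun x hx t ht => by
        have : 0 ≤ A * r₀ ^ (2 * s) / E := by positivity
        linarith [huB x (hΩ hx) t (hI ht)]
      -- At the first scale the level exceeds `B`, so the tails of `u` and `-u` vanish at all times
      -- outside `N`.
      have hzero : ∀ v : Space d → ℝ → ℝ, (∀ x t, |v x t| = |u x t|) → ∀ S, S = h₀ + δ →
          TailBound s lam Lam ρ E N p.1 p.2 r₀ S (h₀ + δ) v := by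
        intro v hv S hS t ht htN K hK x _
        have h1 := (measurePreserving_add_left volume x).quasiMeasurePreserving.ae
          (hNB t (hI ht) htN)
        have h2 : ∫⁻ y, ENNReal.ofReal (v (x + y) t - S) * ENNReal.ofReal (K y) = 0 := by
          rw [← lintegral_zero (μ := (volume : Measure (Space d)))]
          refine lintegral_congr_ae ?_
          filter_upwards [h1] with y hy
          have : 0 ≤ A * r₀ ^ (2 * s) / E := by positivity
          rw [← hv] at hy
          rw [ENNReal.ofReal_of_nonpos (by linarith [le_abs_self (v (x + y) t)]), zero_mul]
        rw [h2]
        exact zero_le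
      refine ⟨h₀ + δ, fun x hx t ht => ?_, hzero u (fun _ _ => rfl) _ rfl,
        hzero _ (fun x t => abs_neg _) _ (by ring)⟩
      have := abs_le.1 (hle x hx t ht)
      constructor <;> linarith
    | succ j ih =>
      intro hj
      have hσj : σ ^ j ≤ 1 := pow_le_one₀ hσ0.le hσ1.le
      have hrj : σ ^ j * r₀ ≤ r₀ := by nlinarith
      have hTj : (σ ^ j * r₀) ^ (2 * s) ≤ r₀ ^ (2 * s) := by gcongr
      have hσp : σ ^ (2 * s) ≤ σ ^ α := Real.rpow_le_rpow_of_exponent_ge hσ0 hσ1.le hα2.le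
      have hTeq : (σ ^ j * r₀) ^ (2 * s) = (σ ^ (2 * s)) ^ j * r₀ ^ (2 * s) := by
        rw [Real.mul_rpow (by positivity) hr₀p.le, ← Real.rpow_natCast, ← Real.rpow_mul hσ0.le,
          mul_comm (j : ℝ), Real.rpow_mul hσ0.le, Real.rpow_natCast]
      have hstep := G.oscBound_step hs0 hE hCw0.le hCw hσ0 hσ4 hσs hα0 hαθ hαE hρ
        (hj j (Nat.lt_succ_self j)) (n := n₀ - k * j) (by
          rw [hσ, hr₀, zpow_sub₀ two_ne_zero, one_div, inv_pow, inv_pow, ← pow_mul,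
            div_eq_inv_mul]
          norm_cast)
        hne (hD _ (by positivity) (by linarith)) hsub hsub' hcont
        ((Metric.ball_subset_ball (by linarith)).trans hΩ)
        ((Icc_subset_Icc_left (by linarith)).trans hI) (h := (σ ^ α) ^ j * (h₀ + δ))
        (by positivity) (by
          rw [hTeq]
          have h1 : (σ ^ (2 * s)) ^ j ≤ (σ ^ α) ^ j := by gcongr
          have h2 : A * r₀ ^ (2 * s) ≤ E * (h₀ + δ) := by
            rw [div_le_iff₀ hE] at hAh; linarith
          calc A * ((σ ^ (2 * s)) ^ j * r₀ ^ (2 * s))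
              = (σ ^ (2 * s)) ^ j * (A * r₀ ^ (2 * s)) := by ring
            _ ≤ (σ ^ α) ^ j * (E * (h₀ + δ)) := by gcongr
            _ = _ := by ring) hN
        (ih fun i hi => hj i (hi.trans (Nat.lt_succ_self j)))
      have e1 : σ ^ (j + 1) * r₀ = σ * (σ ^ j * r₀) := by ring
      have e2 : (σ ^ α) ^ (j + 1) * (h₀ + δ) = σ ^ α * ((σ ^ α) ^ j * (h₀ + δ)) := by ring
      rw [e1, e2]
      exact hstep
  -- The cylinders extend backwards in time, so they are centred at the later of the two points.
  have hpair : ∀ p ∈ parCyl d s (R / 4), ∀ q ∈ parCyl d s (R / 4), q.2 ≤ p.2 →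
      ρ < parDist s p q →
      |u p.1 p.2 - u q.1 q.2| ≤ 2 * (parDist s p q / (σ * r₀)) ^ α * h₀ := by
    intro p hp q hq hqp hpq
    set D' := parDist s p q with hD'
    have hD'p : 0 < D' := hρ.trans_lt hpq
    have hmemR : ∀ p ∈ parCyl d s (R / 4), p.1 ∈ Metric.ball (0 : Space d) R ∧
        p.2 ∈ timeInterval s R := fun p hp => by
      refine ⟨Metric.ball_subset_ball (by linarith) hp.1, ?_, hp.2.2⟩
      have h1 := hp.2.1
      have : (R / 4) ^ (2 * s) ≤ R ^ (2 * s) := by gcongr; linarith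
      linarith
    rcases le_or_gt D' r₀ with hle | hlt
    · obtain ⟨j, hj1, hj2⟩ := exists_nat_pow_near_of_lt_one (div_pos hD'p hr₀p)
        ((div_le_one hr₀p).2 hle) hσ0 hσ1
      rw [lt_div_iff₀ hr₀p] at hj1
      rw [div_le_iff₀ hr₀p] at hj2
      have hbound : ∀ δ > 0, |u p.1 p.2 - u q.1 q.2|
          ≤ 2 * (D' / (σ * r₀)) ^ α * (h₀ + δ) := by
        intro δ hδ
        -- Here `σ^(j+1) r₀ < D' ≤ σ^j r₀`. Reaching level `j` takes steps only from levels `i < j`,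
        -- whose radii are at least `D' > ρ`; this is the role of the restriction on the distance.
        obtain ⟨S, hS, -, -⟩ := hosc δ hδ p hp j fun i hi => by
          refine hpq.le.trans (hj2.trans ?_)
          gcongr ?_ * _
          exact pow_le_pow_of_le_one hσ0.le hσ1.le hi.le
        have hrj : 0 < σ ^ j * r₀ := by positivity
        have hTj : 0 < (σ ^ j * r₀) ^ (2 * s) := by positivity
        have h1 := hS p.1 (Metric.mem_ball_self (by positivity)) p.2 ⟨by linarith, le_rfl⟩
        have h2 := hS q.1 (by
          rw [mem_ball_iff_norm, norm_sub_rev]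
          have : ‖p.1 - q.1‖ ≤ D' := le_max_left _ _
          linarith) q.2 ⟨by
            have := abs_sub_le_of_parDist_le hs0 hj2
            linarith [le_abs_self (p.2 - q.2)], hqp⟩
        have h3 : |u p.1 p.2 - u q.1 q.2| ≤ 2 * ((σ ^ α) ^ j * (h₀ + δ)) := by
          rw [abs_le]
          constructor <;> linarith [h1.1, h1.2, h2.1, h2.2]
        have h4 : (σ ^ α) ^ j ≤ (D' / (σ * r₀)) ^ α := by
          rw [← Real.rpow_natCast, ← Real.rpow_mul hσ0.le, mul_comm, Real.rpow_mul hσ0.le,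
            Real.rpow_natCast]
          refine Real.rpow_le_rpow (by positivity) ?_ hα0.le
          rw [le_div_iff₀ (by positivity)]
          calc _ = σ ^ (j + 1) * r₀ := by ring
            _ ≤ _ := hj1.le
        calc _ ≤ 2 * ((σ ^ α) ^ j * (h₀ + δ)) := h3
          _ ≤ 2 * ((D' / (σ * r₀)) ^ α * (h₀ + δ)) := by gcongr
          _ = _ := by ring
      set X := 2 * (D' / (σ * r₀)) ^ α with hX
      have hX0 : 0 < X := by positivity
      refine le_of_forall_pos_le_add fun η hη => ?_
      have := hbound (η / X) (by positivity)
      rw [mul_add, mul_div_cancel₀ _ hX0.ne'] at this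
      exact this
    · have h1 := hmemR p hp
      have h2 := hmemR q hq
      have h3 := huB p.1 h1.1 p.2 h1.2
      have h4 := huB q.1 h2.1 q.2 h2.2
      have h5 : B ≤ h₀ := by
        have : 0 ≤ A * r₀ ^ (2 * s) / E := by positivity
        linarith
      have h6 : 1 ≤ (D' / (σ * r₀)) ^ α := by
        refine Real.one_le_rpow ?_ hα0.le
        rw [one_le_div (by positivity)]
        nlinarith
      calc _ ≤ |u p.1 p.2| + |u q.1 q.2| := abs_sub _ _
        _ ≤ 2 * 1 * h₀ := by linarith
        _ ≤ _ := by gcongr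
  have hpair' : ∀ p ∈ parCyl d s (R / 4), ∀ q ∈ parCyl d s (R / 4), ρ < parDist s p q →
      |u p.1 p.2 - u q.1 q.2| ≤ 2 * (parDist s p q / (σ * r₀)) ^ α * h₀ := by
    intro p hp q hq hpq
    rcases le_total q.2 p.2 with h | h
    · exact hpair p hp q hq h hpq
    · rw [abs_sub_comm, parDist_comm]
      exact hpair q hq p hp h (by rwa [parDist_comm])
  intro p hp q hq hpq
  have hD'p : 0 < parDist s p q := hρ.trans_lt hpq
  rw [div_le_iff₀ (by positivity)]
  refine (hpair' p hp q hq hpq).trans ?_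
  set D' := parDist s p q
  have h1 : D' / (σ * r₀) ≤ 2 / (σ * κ) * (D' / R) := by
    rw [div_mul_div_comm, div_le_div_iff₀ (by positivity) (by positivity)]
    have : κ * R ≤ 2 * r₀ := by linarith
    calc D' * (σ * κ * R) = D' * σ * (κ * R) := by ring
      _ ≤ D' * σ * (2 * r₀) := by gcongr
      _ = _ := by ring
  have h2 : (D' / (σ * r₀)) ^ α ≤ (2 / (σ * κ)) ^ α * (D' ^ α / R ^ α) := by
    rw [← Real.div_rpow hD'p.le hR.le, ← Real.mul_rpow (by positivity) (by positivity)]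
    gcongr
  have h3 : h₀ ≤ (1 + 1 / E) * (B + R ^ (2 * s) * A) := by
    have : r₀ ^ (2 * s) ≤ R ^ (2 * s) := by gcongr; linarith
    have h4 : A * r₀ ^ (2 * s) / E ≤ A * R ^ (2 * s) / E := by gcongr
    have h5 : 0 ≤ B / E := by positivity
    have h6 : 0 ≤ A * R ^ (2 * s) := by positivity
    calc h₀ ≤ B + A * R ^ (2 * s) / E := by rw [hh₀]; linarith
      _ ≤ B + A * R ^ (2 * s) / E + B / E + A * R ^ (2 * s) := by linarith
      _ = _ := by ring
  calc 2 * (D' / (σ * r₀)) ^ α * h₀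
      ≤ 2 * ((2 / (σ * κ)) ^ α * (D' ^ α / R ^ α)) * ((1 + 1 / E) * (B + R ^ (2 * s) * A)) := by
        gcongr
    _ = _ := by ring

/-! ### The two cases of the theorem -/

theorem continuousOn_of_viscosity {d : ℕ} {F F' : (Space d → ℝ) → Space d → ℝ}
    {f f' : Space d → ℝ → ℝ} {Ω : Set (Space d)} {I : Set ℝ} {u : Space d → ℝ → ℝ}
    (h : IsViscositySubsolution F f Ω I u) (h' : IsViscositySupersolution F' f' Ω I u) :
    ContinuousOn (Function.uncurry u) (Ω ×ˢ I) :=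
  continuousOn_iff_lower_upperSemicontinuousOn.2 ⟨h'.2.1, h.2.1⟩

theorem mainTheorem4 (d : ℕ) (hd : 1 ≤ d) (s lam Lam : ℝ) (hs0 : 0 < s) (hs1 : s < 1)
    (hlam : 0 < lam) (hLam : 0 < Lam) :
    (1 / 2 ≤ s → ∀ R₀ : ℝ, 0 < R₀ →
      ∃ α : ℝ, 0 < α ∧ α < 2 * s ∧ ∃ C : ℝ, 0 < C ∧
        ∀ ρ R A : ℝ, 0 ≤ ρ → (kernelClass d s lam Lam ρ).Nonempty →
          2 * ρ < R → R ≤ R₀ → 0 ≤ A →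
          ∀ u : Space d → ℝ → ℝ, SolvesWithDrift s lam Lam ρ R A u →
            PartialHolderEstimate s ρ R A α C u) ∧
    (∃ α : ℝ, 0 < α ∧ α < 2 * s ∧ ∃ C : ℝ, 0 < C ∧
      ∀ ρ R A : ℝ, 0 ≤ ρ → (kernelClass d s lam Lam ρ).Nonempty →
        2 * ρ < R → 0 ≤ A →
        ∀ u : Space d → ℝ → ℝ, SolvesWithoutDrift s lam Lam ρ R A u →
          PartialHolderEstimate s ρ R A α C u) := by
  refine ⟨fun hs R₀ hR₀ => ?_, ?_⟩
  -- For `s ≥ 1/2` the relative strength `Λ r^(2s-1)` of the drift at scale `r` is nondecreasing in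
  -- `r`, so its value at `R₀` bounds it at all scales. This is the source of the dependence on
  -- `R₀`.
  · obtain ⟨α, h1, h2, C, hC, H⟩ := exists_partialHolder d hd hs0 hs1 hlam hLam
      (D₀ := Lam * R₀ ^ (2 * s - 1)) (by positivity)
    refine ⟨α, h1, h2, C, hC, fun ρ R A hρ hne hρR hRR hA u hu => ?_⟩
    refine H ρ R A Lam hρ hne hρR hA (fun r hr hrR => ?_) u hu.1 ?_
      (continuousOn_of_viscosity hu.1 hu.2)
    · have h3 : r ^ (2 * s) = r ^ (2 * s - 1) * r := by
        rw [← Real.rpow_add_one hr.ne']; congr 1; ring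
      have h4 : r ^ (2 * s - 1) ≤ R₀ ^ (2 * s - 1) :=
        Real.rpow_le_rpow hr.le (hrR.trans hRR) (by linarith)
      rw [h3, ← mul_assoc]
      gcongr
    · have h3 := hu.2.neg (F' := fun w x => pucciSup s lam Lam ρ w x + Lam * ‖gradient w x‖)
        fun w x => by
          rw [pucciInf_neg, gradient_neg', norm_neg]; ring
      simpa only [neg_neg] using h3
  · obtain ⟨α, h1, h2, C, hC, H⟩ := exists_partialHolder d hd hs0 hs1 hlam hLam (D₀ := 0) le_rfl
    refine ⟨α, h1, h2, C, hC, fun ρ R A hρ hne hρR hA u hu => ?_⟩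
    have hF : (fun (w : Space d → ℝ) x => pucciSup s lam Lam ρ w x + 0 * ‖gradient w x‖)
        = pucciSup s lam Lam ρ := by
      ext w x; ring
    refine H ρ R A 0 hρ hne hρR hA (fun r _ _ => by simp) u (by rw [hF]; exact hu.1) ?_
      (continuousOn_of_viscosity hu.1 hu.2)
    rw [hF]
    have h3 := hu.2.neg (F' := pucciSup s lam Lam ρ) fun w x => pucciInf_neg s lam Lam ρ w x
    simpa only [neg_neg] using h3
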